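/- Let $j,k\ge 1$ and $n$ be integers with $j+k<n$. For $0<m<n$ let $G(n,m)$ be the set of all $m$-dimensional affine planes in $\mathbb R^n$. Every $\tau\in G(n,m)$ is written uniquely as $\tau=\xi+u$ with $\xi$ in the Grassmannian $G_{n,m}$ of $m$-dimensional linear subspaces and $u\in\xi^\perp$; $|\tau|=|u|$ is the distance from $\tau$ to the origin. Equip $G(n,m)$ with its usual topology and with the measure $d\tau=d\xi\,du$, where $d\xi$ is the rotation-invariant probability measure on $G_{n,m}$ and $du$ is Lebesgue measure on $\xi^\perp$. A function $f$ on $G(n,m)$ is radial if $f(\tau)=f_0(|\tau|)$ for some single-variable function $f_0$. For a function $f$ on $G(n,j)$ and a plane $\zeta=\eta+v\in G(n,k)$, where $\eta\in G_{n,k}$ and $v\in\eta^\perp$, the mixed Radon transform of $f$ is $$(R_{j,k}f)(\zeta)=\int_{G_j(\eta^\perp)}d\xi\int_{\eta}f(\xi+u+v)\,du,$$ that is, the integral of $f$ over all $j$-planes that meet $\zeta$ and are perpendicular to it. Here $G_j(\eta^\perp)$ is the Grassmannian of $j$-dimensional linear subspaces of $\eta^\perp$ with its invariant probability measure, and $du$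 is Lebesgue measure on $\eta$. For a function $\varphi$ on $G(n,k)$ and a plane $\tau=\xi+u\in G(n,j)$, where $\xi\in G_{n,j}$ and $u\in\xi^\perp$, the dual transform is $$(R_{k,j}\varphi)(\tau)=\int_{G_k(\xi^\perp)}d\eta\int_{\xi}\varphi(\eta+u+v)\,dv .$$ All integrals are Lebesgue integrals, and a value of a transform is called finite if the defining integral converges absolutely. **(A)** Let $f$ be a locally integrable (real- or complex-valued) function on $G(n,j)$ such that, for some $a>0$, $$\int_{|\tau|>a}|f(\tau)|\,|\tau|^{k+j-n}\,d\tau<\infty .\qquad (1)$$ Then $(R_{j,k}f)(\zeta)$ is finite for almost every $\zeta\in G(n,k)$. If $f$ is a nonnegative, radial, locally integrable function on $G(n,j)$ for which (1) fails (that is, there is no $a>0$ for which (1) holds), then $(R_{j,k}f)(\zeta)=\infty$ for every $\zeta\in G(n,k)$. **(B)** Let $\varphi$ be a locally integrable (real- or complex-valued) function on $G(n,k)$ such that, for some $a>0$, $$\int_{|\zeta|>a}|\varphi(\zeta)|\,|\zeta|^{k+j-n}\,d\zeta<\infty .\qquad (2)$$ Then $(R_{k,j}\varphi)(\tau)$ is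 finite for almost every $\tau\in G(n,j)$. If $\varphi$ is a nonnegative, radial, locally integrable function on $G(n,k)$ for which (2) fails (that is, there is no $a>0$ for which (2) holds), then $(R_{k,j}\varphi)(\tau)=\infty$ for every $\tau\in G(n,j)$. -/

import Mathlib

open MeasureTheory Module

open scoped ENNReal

namespace MixedRadon

section Grassmannian

variable (V : Type*) [NormedAddCommGroup V] [InnerProductSpace ℝ V] [FiniteDimensional ℝ V]

/-! ### The orthogonal group and its normalized Haar measure -/

/-- The orthogonal group of the Euclidean space `V`, with the topology of the operator norm. -/
abbrev OrthGroup : Type _ := unitary (V →L[ℝ] V)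

instance : CompactSpace (OrthGroup V) := by
  refine isCompact_iff_compactSpace.mp (Metric.isCompact_of_isClosed_isBounded ?_ ?_)
  · exact isClosed_unitary
  · refine (Metric.isBounded_closedBall (x := (0 : V →L[ℝ] V)) (r := 1)).subset ?_
    intro u hu
    rw [mem_closedBall_zero_iff]
    refine ContinuousLinearMap.opNorm_le_bound _ zero_le_one fun x => ?_
    have h := (Unitary.linearIsometryEquiv ⟨u, hu⟩).norm_map x
    rw [one_mul]
    exact h.le

/-- The invariant (Haar) probability measure on the orthogonal group. -/
noncomputable def orthHaar : Measure (OrthGroup V) :=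
  Measure.haarMeasure (⊤ : TopologicalSpace.PositiveCompacts (OrthGroup V))

instance : IsProbabilityMeasure (orthHaar V) :=
  ⟨Measure.haarMeasure_self (K₀ := (⊤ : TopologicalSpace.PositiveCompacts (OrthGroup V)))⟩

/-! ### The Grassmannian of `j`-dimensional linear subspaces -/

/-- The set `G_j(V)` of all `j`-dimensional linear subspaces of `V`. -/
@[ext]
structure LinGr (j : ℕ) where
  space : Submodule ℝ V
  finrank_eq : finrank ℝ space = j

variable {V} {j : ℕ}

namespace LinGr

/-- The orthogonal projection of `V` onto the subspace `ξ`. -/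
noncomputable def proj (ξ : LinGr V j) : V →L[ℝ] V := ξ.space.starProjection

/-- The usual topology of the Grassmannian: subspaces are close when the orthogonal projections
onto them are close. -/
noncomputable instance : TopologicalSpace (LinGr V j) := TopologicalSpace.induced proj inferInstance

noncomputable instance : MeasurableSpace (LinGr V j) := borel _

instance : BorelSpace (LinGr V j) := ⟨rfl⟩

instance : SecondCountableTopology (LinGr V j) :=
  TopologicalSpace.secondCountableTopology_induced _ _ proj

/-- The action of the orthogonal group on subspaces, `ξ ↦ γ ξ`. -/
noncomputable def rotate (γ : OrthGroup V) (ξ : LinGr V j) : LinGr V j where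
  space := ξ.space.map (Unitary.linearIsometryEquiv γ).toLinearEquiv.toLinearMap
  finrank_eq := by rw [LinearEquiv.finrank_map_eq, ξ.finrank_eq]

theorem continuous_proj : Continuous (proj : LinGr V j → V →L[ℝ] V) := continuous_induced_dom

theorem continuous_rotate (ξ : LinGr V j) : Continuous fun γ : OrthGroup V => rotate γ ξ := by
  rw [continuous_induced_rng]
  have h : (proj ∘ fun γ : OrthGroup V => rotate γ ξ) =
      fun γ : OrthGroup V => (γ : V →L[ℝ] V) * ξ.proj * ((star γ : OrthGroup V) : V →L[ℝ] V) := by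
    funext γ
    ext x
    exact Submodule.starProjection_map_apply (Unitary.linearIsometryEquiv γ) ξ.space x
  rw [h]
  fun_prop

open Classical in
/-- The `O(V)`-invariant probability measure on `G_j(V)`: the image of the Haar probability
measure under an orbit map `γ ↦ γ ξ₀` (it does not depend on `ξ₀`). The value `0` is only
taken when `G_j(V)` is empty. -/
noncomputable def prob (V : Type*) [NormedAddCommGroup V] [InnerProductSpace ℝ V]
    [FiniteDimensional ℝ V] (j : ℕ) : Measure (LinGr V j) :=
  if h : Nonempty (LinGr V j) then
    (orthHaar V).map fun γ => rotate γ h.some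
  else 0

instance : IsFiniteMeasure (prob V j) := by
  unfold prob
  split_ifs <;> infer_instance

theorem isProbabilityMeasure_prob (hj : j ≤ finrank ℝ V) : IsProbabilityMeasure (prob V j) := by
  have h : Nonempty (LinGr V j) := by
    have hb := (finBasis ℝ V).linearIndependent.comp _ (Fin.castLE_injective hj)
    exact ⟨⟨Submodule.span ℝ (Set.range _), (finrank_span_eq_card hb).trans (Fintype.card_fin j)⟩⟩
  rw [prob, dif_pos h]
  exact Measure.isProbabilityMeasure_map (continuous_rotate _).measurable.aemeasurable

/-- A `j`-dimensional subspace of a subspace `W` of `V`, regarded as a subspace of `V`. -/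
def lift {W : Submodule ℝ V} (ξ : LinGr W j) : LinGr V j where
  space := ξ.space.map W.subtype
  finrank_eq :=
    (Submodule.equivMapOfInjective W.subtype W.injective_subtype ξ.space).finrank_eq.symm.trans
      ξ.finrank_eq

theorem continuous_lift (W : Submodule ℝ V) :
    Continuous (lift : LinGr W j → LinGr V j) := by
  apply continuous_induced_rng.mpr
  have h : (proj ∘ lift : LinGr W j → V →L[ℝ] V) =
      fun ξ => (W.subtypeL.comp ξ.proj).comp W.orthogonalProjectionOnto := by
    funext ξ
    ext x
    refine Submodule.eq_starProjection_of_mem_of_inner_eq_zero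
      (K := ξ.space.map W.subtype) (u := x) ?_ ?_
    · exact Submodule.mem_map_of_mem (Submodule.starProjection_apply_mem ξ.space _)
    · rintro _ ⟨w, hw, rfl⟩
      have h1 : inner ℝ (x - W.starProjection x) (w : V) = 0 :=
        Submodule.starProjection_inner_eq_zero x w w.2
      have h2 := Submodule.starProjection_inner_eq_zero (K := ξ.space)
        (W.orthogonalProjectionOnto x) w hw
      rw [Submodule.coe_inner, AddSubgroupClass.coe_sub, inner_sub_left] at h2
      rw [inner_sub_left] at h1 ⊢
      have h3 : (W.orthogonalProjectionOnto x : V) = W.starProjection x := rfl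
      rw [h3] at h2
      have h4 : inner ℝ (((W.subtypeL.comp ξ.proj).comp W.orthogonalProjectionOnto) x) (w : V) =
        inner ℝ ((ξ.space.starProjection (W.orthogonalProjectionOnto x) : W) : V) (w : V) := rfl
      rw [Submodule.subtype_apply, h4]
      linarith
  rw [h]
  exact (continuous_const.clm_comp continuous_proj).clm_comp continuous_const

end LinGr

/-! ### The affine Grassmannian -/

/-- The set `G(j, V)` of all `j`-dimensional affine planes in `V`. -/
@[ext]
structure AffGr (V : Type*) [NormedAddCommGroup V] [InnerProductSpace ℝ V]
    [FiniteDimensional ℝ V] (j : ℕ) where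
  plane : AffineSubspace ℝ V
  nonempty : (plane : Set V).Nonempty
  finrank_eq : finrank ℝ plane.direction = j

namespace AffGr

/-- The linear subspace `ξ` parallel to the plane `τ = ξ + u`. -/
def dir (τ : AffGr V j) : LinGr V j := ⟨τ.plane.direction, τ.finrank_eq⟩

/-- The vector `u ∈ ξᗮ` with `τ = ξ + u`, obtained by projecting any point of `τ` onto `ξᗮ`. -/
noncomputable def foot (τ : AffGr V j) : V := τ.dir.spaceᗮ.starProjection τ.nonempty.some

/-- The Euclidean distance `|τ|` between the plane `τ` and the origin. -/
noncomputable def absDist (τ : AffGr V j) : ℝ := Metric.infDist 0 (τ.plane : Set V)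

/-- The plane `ξ + x`. -/
def mk' (ξ : LinGr V j) (x : V) : AffGr V j where
  plane := AffineSubspace.mk' x ξ.space
  nonempty := AffineSubspace.mk'_nonempty _ _
  finrank_eq := by rw [AffineSubspace.direction_mk', ξ.finrank_eq]

/-- The usual topology of `G(j, V)`: the planes `ξ + u` with `u ∈ ξᗮ` are close when the subspaces
`ξ` and the vectors `u` are. -/
noncomputable instance : TopologicalSpace (AffGr V j) :=
  TopologicalSpace.induced (fun τ => (τ.dir, τ.foot)) inferInstance

noncomputable instance : MeasurableSpace (AffGr V j) := borel _

instance : BorelSpace (AffGr V j) := ⟨rfl⟩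

theorem dir_mk' (ξ : LinGr V j) (x : V) : (mk' ξ x).dir = ξ := by
  ext1
  exact AffineSubspace.direction_mk' _ _

theorem foot_eq_of_mem (τ : AffGr V j) {p : V} (hp : p ∈ τ.plane) :
    τ.foot = τ.dir.spaceᗮ.starProjection p := by
  unfold foot
  rw [← sub_eq_zero, ← map_sub, Submodule.starProjection_apply_eq_zero_iff,
    Submodule.orthogonal_orthogonal]
  exact AffineSubspace.vsub_mem_direction τ.nonempty.some_mem hp

theorem foot_mk' (ξ : LinGr V j) (x : V) : (mk' ξ x).foot = x - ξ.proj x := by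
  rw [foot_eq_of_mem _ (AffineSubspace.self_mem_mk' x ξ.space), dir_mk',
    Submodule.starProjection_orthogonal_val]
  rfl

theorem foot_mem (τ : AffGr V j) : τ.foot ∈ τ.dir.spaceᗮ :=
  Submodule.starProjection_apply_mem _ _

theorem foot_mem_plane (τ : AffGr V j) : τ.foot ∈ τ.plane := by
  have h : τ.foot = -(τ.dir.space.starProjection τ.nonempty.some) +ᵥ τ.nonempty.some := by
    rw [foot, Submodule.starProjection_orthogonal_val, vadd_eq_add]
    abel
  rw [h]
  exact AffineSubspace.vadd_mem_of_mem_direction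
    (neg_mem (Submodule.starProjection_apply_mem τ.dir.space _)) τ.nonempty.some_mem

theorem mk'_dir_foot (τ : AffGr V j) : mk' τ.dir τ.foot = τ := by
  ext1
  exact AffineSubspace.mk'_eq τ.foot_mem_plane

theorem absDist_eq_norm_foot (τ : AffGr V j) : τ.absDist = ‖τ.foot‖ := by
  refine le_antisymm ?_ ?_
  · have h := Metric.infDist_le_dist_of_mem (x := (0 : V)) τ.foot_mem_plane
    rwa [dist_zero_left] at h
  · refine (Metric.le_infDist τ.nonempty).mpr fun p hp => ?_
    rw [dist_zero_left, foot_eq_of_mem τ hp]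
    calc ‖τ.dir.spaceᗮ.starProjection p‖ ≤ ‖τ.dir.spaceᗮ.starProjection‖ * ‖p‖ :=
          ContinuousLinearMap.le_opNorm _ _
      _ ≤ 1 * ‖p‖ := by gcongr; exact Submodule.starProjection_norm_le _
      _ = ‖p‖ := one_mul _

theorem continuous_absDist : Continuous (absDist : AffGr V j → ℝ) := by
  have h : (absDist : AffGr V j → ℝ) = fun τ => ‖τ.foot‖ := funext absDist_eq_norm_foot
  have h' : Continuous fun τ : AffGr V j => (τ.dir, τ.foot) := continuous_induced_dom
  rw [h]
  exact (continuous_snd.comp h').norm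

theorem continuous_mk' : Continuous fun p : LinGr V j × V => mk' p.1 p.2 := by
  apply continuous_induced_rng.mpr
  have h : ((fun τ : AffGr V j => (τ.dir, τ.foot)) ∘ fun p : LinGr V j × V => mk' p.1 p.2) =
      fun p : LinGr V j × V => (p.1, p.2 - p.1.proj p.2) := by
    funext p
    simp only [Function.comp_apply, dir_mk', foot_mk']
  rw [h]
  exact continuous_fst.prodMk (continuous_snd.sub
    ((LinGr.continuous_proj.comp continuous_fst).clm_apply continuous_snd))

end AffGr

/-! ### The measure `dτ = dξ du` on the affine Grassmannian -/

section Measures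

variable [MeasurableSpace V] [BorelSpace V]

/-- The Euclidean volume on the fiber over `ξ`, that is, the image of the Lebesgue measure of `ξᗮ`
under `u ↦ ξ + u`. -/
noncomputable def fiberVolume (ξ : LinGr V j) : Measure (AffGr V j) :=
  (volume : Measure ↥(ξ.spaceᗮ)).map fun u : ↥(ξ.spaceᗮ) => AffGr.mk' ξ (u : V)

/-- The measure `dτ = dξ du` on `G(j, V)`: by `affVolume_apply` and `lintegral_affVolume` below,
integration over `u ∈ ξᗮ` followed by integration over `ξ ∈ G_j(V)`. -/
noncomputable def affVolume (V : Type*) [NormedAddCommGroup V] [InnerProductSpace ℝ V]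
    [FiniteDimensional ℝ V] [MeasurableSpace V] [BorelSpace V] (j : ℕ) : Measure (AffGr V j) :=
  (LinGr.prob V j).bind fiberVolume

theorem measurable_mk'_right (ξ : LinGr V j) : Measurable fun x : V => AffGr.mk' ξ x :=
  (AffGr.continuous_mk'.comp (Continuous.prodMk_right ξ)).measurable

theorem fiberVolume_apply (ξ : LinGr V j) {s : Set (AffGr V j)} (hs : MeasurableSet s) :
    fiberVolume ξ s = volume {u : ↥(ξ.spaceᗮ) | AffGr.mk' ξ (u : V) ∈ s} :=
  Measure.map_apply ((measurable_mk'_right ξ).comp measurable_subtype_coe) hs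

theorem volume_unitBall_eq (ξ : LinGr V j) :
    volume (Metric.closedBall (0 : ξ.space) 1) =
      volume (Metric.closedBall (0 : EuclideanSpace ℝ (Fin j)) 1) := by
  obtain ⟨W, rfl⟩ := ξ
  have h := (stdOrthonormalBasis ℝ W).measurePreserving_repr.measure_preimage
    (s := Metric.closedBall 0 1) Metric.isClosed_closedBall.measurableSet.nullMeasurableSet
  rw [← h]
  congr 1
  ext x
  simp

theorem measurable_fiberVolume : Measurable (fiberVolume : LinGr V j → Measure (AffGr V j)) := by
  refine Measure.measurable_of_measurable_coe _ fun s hs => ?_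
  set c := volume (Metric.closedBall (0 : EuclideanSpace ℝ (Fin j)) 1) with hc
  have hc0 : c ≠ 0 := (Metric.measure_closedBall_pos _ _ one_pos).ne'
  have hct : c ≠ ∞ := measure_closedBall_lt_top.ne
  let T : Set (LinGr V j × V) := {p | AffGr.mk' p.1 p.2 ∈ s ∧ ‖p.1.proj p.2‖ ≤ 1}
  have hT : MeasurableSet T := by
    refine (AffGr.continuous_mk'.measurable hs).inter ?_
    exact (isClosed_le ((LinGr.continuous_proj.comp continuous_fst).clm_apply
      continuous_snd).norm continuous_const).measurableSet
  have key : ∀ ξ : LinGr V j, fiberVolume ξ s = c⁻¹ * volume (Prod.mk ξ ⁻¹' T) := by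
    intro ξ
    have e := ξ.space.measurePreserving_measurableEquivProd (0 : V)
    rw [InnerProductSpace.euclideanHausdorffMeasure_eq_volume] at e
    rw [← e.symm.measure_preimage_equiv]
    have hset : (ξ.space.measurableEquivProd (0 : V)).symm ⁻¹' (Prod.mk ξ ⁻¹' T) =
        Metric.closedBall (0 : ξ.space) 1 ×ˢ {u : ↥(ξ.spaceᗮ) | AffGr.mk' ξ (u : V) ∈ s} := by
      ext ⟨w, u⟩
      have h1 : ξ.proj ((w : V) + (u : V)) = w := by
        rw [map_add]
        have hw : ξ.proj (w : V) = w := Submodule.starProjection_eq_self_iff.mpr w.2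
        have hu : ξ.proj (u : V) = 0 :=
          (Submodule.starProjection_apply_eq_zero_iff ξ.space).mpr u.2
        rw [hw, hu, add_zero]
      have h2 : AffGr.mk' ξ ((w : V) + (u : V)) = AffGr.mk' ξ (u : V) := by
        ext1
        have hm : (u : V) ∈ AffineSubspace.mk' ((w : V) + (u : V)) ξ.space := by
          rw [AffineSubspace.mem_mk', vsub_eq_sub]
          simp
        have hm' := AffineSubspace.mk'_eq hm
        rw [AffineSubspace.direction_mk'] at hm'
        exact hm'.symm
      simp only [Set.mem_preimage, Submodule.measurableEquivProd_symm_apply, vadd_eq_add, add_zero,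
        T, Set.mem_ofPred_eq, h1, h2, Set.mem_prod, mem_closedBall_zero_iff]
      exact and_comm
    rw [hset, Measure.volume_eq_prod, Measure.prod_prod, volume_unitBall_eq, ← mul_assoc,
      ENNReal.inv_mul_cancel hc0 hct, one_mul, fiberVolume_apply ξ hs]
  simp_rw [key]
  exact (measurable_measure_prodMk_left hT).const_mul _

theorem affVolume_apply {s : Set (AffGr V j)} (hs : MeasurableSet s) :
    affVolume V j s =
      ∫⁻ ξ, volume {u : ↥(ξ.spaceᗮ) | AffGr.mk' ξ (u : V) ∈ s} ∂LinGr.prob V j := by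
  rw [affVolume, Measure.bind_apply hs measurable_fiberVolume.aemeasurable]
  simp_rw [fiberVolume_apply _ hs]

theorem lintegral_affVolume {f : AffGr V j → ℝ≥0∞} (hf : Measurable f) :
    ∫⁻ τ, f τ ∂affVolume V j =
      ∫⁻ ξ : LinGr V j, ∫⁻ u : ↥(ξ.spaceᗮ), f (AffGr.mk' ξ (u : V)) ∂volume
        ∂LinGr.prob V j := by
  rw [affVolume, Measure.lintegral_bind measurable_fiberVolume.aemeasurable hf.aemeasurable]
  refine lintegral_congr fun ξ => ?_
  exact lintegral_map hf ((measurable_mk'_right ξ).comp measurable_subtype_coe)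

/-! ### The mixed Radon transform -/

/-- For a `k`-plane `ζ = η + v`, `v ∈ ηᗮ`, the canonical measure `d_ζ τ` on the set of all
`j`-planes that meet `ζ` and are perpendicular to it. These planes are `ξ + u + v` with
`ξ ∈ G_j(ηᗮ)` and `u ∈ η`, and `d_ζ τ` is the image of the product of the invariant probability
measure of `G_j(ηᗮ)` and the Lebesgue measure of `η`. -/
noncomputable def incidenceMeasure {k : ℕ} (j : ℕ) (ζ : AffGr V k) : Measure (AffGr V j) :=
  ((LinGr.prob ↥(ζ.dir.spaceᗮ) j).prod (volume : Measure ζ.dir.space)).map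
    fun p : LinGr ↥(ζ.dir.spaceᗮ) j × ζ.dir.space => AffGr.mk' p.1.lift ((p.2 : V) + ζ.foot)

theorem lintegral_incidenceMeasure {k : ℕ} (ζ : AffGr V k) {f : AffGr V j → ℝ≥0∞}
    (hf : Measurable f) :
    ∫⁻ τ, f τ ∂incidenceMeasure j ζ =
      ∫⁻ ξ : LinGr ↥(ζ.dir.spaceᗮ) j, ∫⁻ u : ζ.dir.space,
        f (AffGr.mk' ξ.lift ((u : V) + ζ.foot)) ∂volume ∂LinGr.prob ↥(ζ.dir.spaceᗮ) j := by
  have hm : Measurable fun p : LinGr ↥(ζ.dir.spaceᗮ) j × ζ.dir.space =>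
      AffGr.mk' p.1.lift ((p.2 : V) + ζ.foot) := by
    refine (AffGr.continuous_mk'.comp (f := fun p : LinGr ↥(ζ.dir.spaceᗮ) j × ζ.dir.space =>
      (p.1.lift, (p.2 : V) + ζ.foot)) ?_).measurable
    exact ((LinGr.continuous_lift _).comp continuous_fst).prodMk
      ((continuous_subtype_val.comp continuous_snd).add continuous_const)
  rw [incidenceMeasure, lintegral_map hf hm,
    lintegral_prod (fun p : LinGr ↥(ζ.dir.spaceᗮ) j × ζ.dir.space =>
      f (AffGr.mk' p.1.lift ((p.2 : V) + ζ.foot))) (hf.comp hm).aemeasurable]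

/-- The value `(R_{j,k} f)(ζ)` of the mixed `j`-plane to `k`-plane Radon transform exists in the
Lebesgue sense and is finite. -/
def MixedRadonFinite {𝕜 : Type*} [RCLike 𝕜] {k : ℕ} (f : AffGr V j → 𝕜) (ζ : AffGr V k) : Prop :=
  Integrable f (incidenceMeasure j ζ)

/-- The mixed `j`-plane to `k`-plane Radon transform `(R_{j,k} f)(ζ)` of a function with values
in `[0, ∞]`. -/
noncomputable def mixedRadon {k : ℕ} (f : AffGr V j → ℝ≥0∞) (ζ : AffGr V k) : ℝ≥0∞ :=
  ∫⁻ τ, f τ ∂incidenceMeasure j ζ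

/-- `∫_{|τ| > a} |f(τ)| |τ|^p dτ < ∞` for some `a > 0`. -/
def TailIntegrable {𝕜 : Type*} [RCLike 𝕜] (f : AffGr V j → 𝕜) (p : ℤ) : Prop :=
  ∃ a : ℝ, 0 < a ∧
    ∫⁻ τ in {τ : AffGr V j | a < τ.absDist}, ‖f τ‖ₑ * ENNReal.ofReal (τ.absDist ^ p)
      ∂affVolume V j < ∞

/-- `f` is radial: `f(τ) = f₀(|τ|)`. -/
def IsRadial {𝕜 : Type*} (f : AffGr V j → 𝕜) : Prop :=
  ∃ f₀ : ℝ → 𝕜, ∀ τ, f τ = f₀ τ.absDist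

end Measures

end Grassmannian

end MixedRadon

open MixedRadon

/-!
The two transforms integrate over pairs of perpendicular planes that meet, and these pairs carry one
symmetric measure. A random `k`-subspace `η` followed by a random `j`-subspace `ξ` of `ηᗮ` has the
law of a random rotation of a fixed orthogonal pair (`LinGr.lintegral_prob_probOn`, from the
uniqueness of the invariant measure of the Grassmannian and the unimodularity of the orthogonal
group). Together with the splitting of Lebesgue measure along `η` and `ηᗮ` it follows that
`∫ φ · R_{j,k} f` is the integral of `φ(η + x) f(ξ + x)` over all rotated pairs and all points `x`,
whence the duality `∫ φ · R_{j,k} f = ∫ f · R_{k,j} φ` (`lintegral_mul_mixedRadon_comm`).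

For almost everywhere finiteness, `φ` is taken to be the indicator function of `|ζ| ≤ A`. A plane
`τ` at distance `t` from the origin has `(R_{k,j} φ)(τ) ≤ C · p`, where `p` is the probability that
a random `k`-subspace of an `(n - j)`-dimensional space passes within distance `A` of a fixed vector
of length `t`. This probability is `O(t ^ (j + k - n))` (`prob_norm_sub_proj_le`), so that the tail
condition bounds the part `|τ| > a` of `∫ |f| · R_{k,j} φ`; the part `|τ| ≤ a` is finite because
that set of planes is compact. Hence `R_{j,k} |f|` is integrable over each ball. The same duality,
applied to the indicator function of a null set, shows that changing `f` on a null set does not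
affect almost all values of the transform.

For radial `f`, the value at `ζ` is an average over `s ≤ |ζ|` of the integrals of
`f₀ (√(r ^ 2 + s ^ 2)) r ^ (k - 1) dr`, each of which is at least a constant times
`∫_{t > a} f₀(t) t ^ (k - 1) dt` for large `a` (`lintegral_Ioi_le_lintegral_sqrt`). In polar
coordinates the failure of the tail condition says exactly that the last integral diverges.
-/

/-! ### The orthogonal group and the Grassmannian -/

namespace MixedRadon

section Rotations

variable {V : Type*} [NormedAddCommGroup V] [InnerProductSpace ℝ V] [FiniteDimensional ℝ V]
  {W : Type*} [NormedAddCommGroup W] [InnerProductSpace ℝ W] [FiniteDimensional ℝ W] {j k : ℕ}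

instance : (orthHaar V).IsHaarMeasure := by
  unfold orthHaar
  infer_instance

instance : PolishSpace (OrthGroup V) := isClosed_unitary.polishSpace

/-- The orthogonal group is compact, hence unimodular. -/
instance : (orthHaar V).IsMulRightInvariant := by
  refine ⟨fun γ => ?_⟩
  have : IsProbabilityMeasure ((orthHaar V).map (· * γ)) :=
    Measure.isProbabilityMeasure_map (measurable_mul_const γ).aemeasurable
  exact Measure.isHaarMeasure_eq_of_isProbabilityMeasure _ _

namespace LinGr

theorem proj_injective : Function.Injective (proj : LinGr V j → V →L[ℝ] V) := fun _ _ h =>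
  LinGr.ext (Submodule.starProjection_inj.mp h)

instance : T2Space (LinGr V j) :=
  T2Space.of_injective_continuous proj_injective continuous_proj

theorem proj_rotate (γ : OrthGroup V) (ξ : LinGr V j) :
    (rotate γ ξ).proj = (γ : V →L[ℝ] V) * ξ.proj * ((star γ : OrthGroup V) : V →L[ℝ] V) := by
  ext x
  exact Submodule.starProjection_map_apply (Unitary.linearIsometryEquiv γ) ξ.space x

theorem proj_rotate_apply (γ : OrthGroup V) (ξ : LinGr V j) (x : V) :
    (rotate γ ξ).proj ((γ : V →L[ℝ] V) x) = (γ : V →L[ℝ] V) (ξ.proj x) := by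
  have h : ((star γ : OrthGroup V) : V →L[ℝ] V) ((γ : V →L[ℝ] V) x) = x :=
    (Unitary.linearIsometryEquiv γ).symm_apply_apply x
  rw [proj_rotate]
  change (γ : V →L[ℝ] V) (ξ.proj (((star γ : OrthGroup V) : V →L[ℝ] V) _)) = _
  rw [h]

theorem continuous_rotate_uncurry :
    Continuous fun p : OrthGroup V × LinGr V j => rotate p.1 p.2 := by
  rw [continuous_induced_rng]
  have h : (proj ∘ fun p : OrthGroup V × LinGr V j => rotate p.1 p.2) = fun p =>
      (p.1 : V →L[ℝ] V) * p.2.proj * ((star p.1 : OrthGroup V) : V →L[ℝ] V) :=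
    funext fun p => proj_rotate p.1 p.2
  rw [h]
  have h' := continuous_proj (V := V) (j := j)
  fun_prop

theorem continuous_rotate_right (γ : OrthGroup V) :
    Continuous fun ξ : LinGr V j => rotate γ ξ :=
  continuous_rotate_uncurry.comp (Continuous.prodMk_right γ)

theorem rotate_mul (γ δ : OrthGroup V) (ξ : LinGr V j) :
    rotate (γ * δ) ξ = rotate γ (rotate δ ξ) := by
  ext1
  exact Submodule.map_comp _ _ ξ.space

/-- The orthogonal group acts transitively on the Grassmannian. -/
theorem exists_rotate_eq (ξ ξ' : LinGr V j) : ∃ γ : OrthGroup V, rotate γ ξ = ξ' := by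
  have hd : finrank ℝ ξ.space = finrank ℝ ξ'.space := ξ.finrank_eq.trans ξ'.finrank_eq.symm
  let e : ξ.space ≃ₗᵢ[ℝ] ξ'.space :=
    (stdOrthonormalBasis ℝ ξ.space).equiv (stdOrthonormalBasis ℝ ξ'.space) (finCongr hd)
  let L : ξ.space →ₗᵢ[ℝ] V := ξ'.space.subtypeₗᵢ.comp e.toLinearIsometry
  let γ : OrthGroup V :=
    Unitary.linearIsometryEquiv.symm (L.extend.toLinearIsometryEquiv rfl)
  refine ⟨γ, ?_⟩
  ext1
  refine Submodule.eq_of_le_of_finrank_eq ?_ ((rotate γ ξ).finrank_eq.trans ξ'.finrank_eq.symm)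
  rintro _ ⟨x, hx, rfl⟩
  have h : L.extend x = L ⟨x, hx⟩ := L.extend_apply ⟨x, hx⟩
  change L.extend x ∈ ξ'.space
  rw [h]
  exact (e ⟨x, hx⟩).2

instance : CompactSpace (LinGr V j) := by
  refine ⟨?_⟩
  rcases isEmpty_or_nonempty (LinGr V j) with h | ⟨⟨ξ⟩⟩
  · rw [Set.univ_eq_empty_iff.mpr h]
    exact isCompact_empty
  · have h : Set.range (fun γ : OrthGroup V => rotate γ ξ) = Set.univ :=
      Set.range_eq_univ.mpr fun ξ' => exists_rotate_eq ξ ξ'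
    rw [← h]
    exact isCompact_range (continuous_rotate ξ)

/-- Measurability on the Grassmannian can be tested on the orthogonal group. The orbit map has no
evident measurable section; the statement rests on the separation of disjoint analytic sets. -/
theorem measurable_of_comp_rotate {Y β : Type*} [TopologicalSpace Y] [PolishSpace Y]
    [MeasurableSpace Y] [BorelSpace Y] [MeasurableSpace β] (η : LinGr V k)
    {g : LinGr V k × Y → β}
    (hg : Measurable fun p : OrthGroup V × Y => g (rotate p.1 η, p.2)) : Measurable g := by
  have hm : Measurable (Prod.map (fun γ : OrthGroup V => rotate γ η) (id : Y → Y)) :=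
    (continuous_rotate η).measurable.prodMap measurable_id
  have hs : Function.Surjective (Prod.map (fun γ : OrthGroup V => rotate γ η) (id : Y → Y)) :=
    Function.Surjective.prodMap (exists_rotate_eq η) Function.surjective_id
  exact (hm.measurable_comp_iff_of_surjective hs).mp hg

/-! ### The invariant probability measure -/

/-- Any orbit map may be used to define the invariant measure of the Grassmannian. -/
theorem prob_eq_map_rotate (ξ : LinGr V j) :
    prob V j = (orthHaar V).map fun γ => rotate γ ξ := by
  have h : Nonempty (LinGr V j) := ⟨ξ⟩
  rw [prob, dif_pos h]
  obtain ⟨δ, hδ⟩ := exists_rotate_eq ξ h.some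
  rw [← hδ]
  simp_rw [← rotate_mul]
  rw [← Function.comp_def (fun γ => rotate γ ξ) (fun γ => γ * δ),
    ← Measure.map_map (continuous_rotate ξ).measurable (measurable_mul_const δ),
    map_mul_right_eq_self]

theorem lintegral_prob (ξ : LinGr V j) {F : LinGr V j → ℝ≥0∞} (hF : Measurable F) :
    ∫⁻ ξ', F ξ' ∂prob V j = ∫⁻ γ, F (rotate γ ξ) ∂orthHaar V := by
  rw [prob_eq_map_rotate ξ, lintegral_map hF (continuous_rotate ξ).measurable]

theorem map_rotate_prob (γ : OrthGroup V) : (prob V j).map (rotate γ) = prob V j := by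
  rcases isEmpty_or_nonempty (LinGr V j) with h | ⟨⟨ξ⟩⟩
  · exact Subsingleton.elim _ _
  · rw [prob_eq_map_rotate ξ, Measure.map_map (continuous_rotate_right γ).measurable
      (continuous_rotate ξ).measurable, Function.comp_def]
    simp_rw [← rotate_mul]
    rw [← Function.comp_def (fun γ => rotate γ ξ) (fun δ => γ * δ),
      ← Measure.map_map (continuous_rotate ξ).measurable (measurable_const_mul γ),
      map_mul_left_eq_self]

/-- The invariant probability measure of the Grassmannian is unique. -/
theorem eq_prob_of_map_rotate_eq (μ : Measure (LinGr V j)) [IsProbabilityMeasure μ]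
    (hμ : ∀ γ : OrthGroup V, μ.map (rotate γ) = μ) : μ = prob V j := by
  obtain ⟨ξ⟩ : Nonempty (LinGr V j) := nonempty_of_isProbabilityMeasure μ
  have : IsProbabilityMeasure (prob V j) := isProbabilityMeasure_prob
    (ξ.finrank_eq.symm.trans_le (Submodule.finrank_le _))
  ext s hs
  have h1 : ∀ γ : OrthGroup V, ∫⁻ ξ', s.indicator 1 (rotate γ ξ') ∂μ = μ s := fun γ => by
    rw [← lintegral_map (measurable_one.indicator hs) (continuous_rotate_right γ).measurable,
      hμ, lintegral_indicator_one hs]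
  have h2 : ∀ ξ' : LinGr V j, ∫⁻ γ, s.indicator 1 (rotate γ ξ') ∂orthHaar V = prob V j s :=
    fun ξ' => by
      rw [← lintegral_prob ξ' (measurable_one.indicator hs), lintegral_indicator_one hs]
  have h3 := lintegral_lintegral_swap (μ := orthHaar V) (ν := μ)
    (f := fun γ ξ' => s.indicator (1 : LinGr V j → ℝ≥0∞) (rotate γ ξ'))
    ((measurable_one.indicator hs).comp continuous_rotate_uncurry.measurable).aemeasurable
  simpa [h1, h2] using h3

/-- The image of a subspace under an isometry between Euclidean spaces. -/
noncomputable def mapIso (e : V ≃ₗᵢ[ℝ] W) (ξ : LinGr V j) : LinGr W j where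
  space := ξ.space.map e.toLinearEquiv.toLinearMap
  finrank_eq := by rw [LinearEquiv.finrank_map_eq, ξ.finrank_eq]

theorem continuous_mapIso (e : V ≃ₗᵢ[ℝ] W) :
    Continuous (mapIso e : LinGr V j → LinGr W j) := by
  rw [continuous_induced_rng]
  have h : (proj ∘ mapIso e : LinGr V j → W →L[ℝ] W) = fun ξ =>
      ((e : V →L[ℝ] W).comp ξ.proj).comp (e.symm : W →L[ℝ] V) := by
    funext ξ
    ext x
    exact Submodule.starProjection_map_apply e ξ.space x
  rw [h]
  exact (continuous_const.clm_comp continuous_proj).clm_comp continuous_const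

theorem map_mapIso_prob (e : V ≃ₗᵢ[ℝ] W) : (prob V j).map (mapIso e) = prob W j := by
  rcases isEmpty_or_nonempty (LinGr V j) with h | ⟨⟨ξ⟩⟩
  · have h' : IsEmpty (LinGr W j) := ⟨fun ξ => h.false (mapIso e.symm ξ)⟩
    exact Subsingleton.elim _ _
  · have : IsProbabilityMeasure (prob V j) := isProbabilityMeasure_prob
      (ξ.finrank_eq.symm.trans_le (Submodule.finrank_le _))
    have : IsProbabilityMeasure ((prob V j).map (mapIso e)) :=
      Measure.isProbabilityMeasure_map (continuous_mapIso e).measurable.aemeasurable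
    refine eq_prob_of_map_rotate_eq _ fun γ => ?_
    let δ : OrthGroup V := Unitary.linearIsometryEquiv.symm
      ((e.trans (Unitary.linearIsometryEquiv γ)).trans e.symm)
    have h : rotate γ ∘ mapIso e = mapIso e ∘ (rotate δ : LinGr V j → LinGr V j) := by
      funext ξ'
      ext x
      constructor
      · rintro ⟨_, ⟨y, hy, rfl⟩, rfl⟩
        refine ⟨_, ⟨y, hy, rfl⟩, ?_⟩
        exact e.apply_symm_apply _
      · rintro ⟨_, ⟨y, hy, rfl⟩, rfl⟩
        refine ⟨_, ⟨y, hy, rfl⟩, ?_⟩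
        exact (e.apply_symm_apply _).symm
    rw [Measure.map_map (continuous_rotate_right γ).measurable (continuous_mapIso e).measurable, h,
      ← Measure.map_map (continuous_mapIso e).measurable (continuous_rotate_right δ).measurable,
      map_rotate_prob]

end LinGr

end Rotations

end MixedRadon

/-! ### Orthogonal pairs of subspaces -/

namespace MixedRadon

section Flags

variable {V : Type*} [NormedAddCommGroup V] [InnerProductSpace ℝ V] [FiniteDimensional ℝ V]
  {j k : ℕ}

theorem norm_extendOrth (W : Submodule ℝ V) (δ : OrthGroup W) (x : V) :
    ‖((δ : W →L[ℝ] W) (W.orthogonalProjectionOnto x) : V) + Wᗮ.starProjection x‖ = ‖x‖ := by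
  have h0 : inner ℝ ((δ : W →L[ℝ] W) (W.orthogonalProjectionOnto x) : V)
      (Wᗮ.starProjection x) = 0 :=
    Submodule.inner_right_of_mem_orthogonal (Subtype.coe_prop _)
      (Submodule.starProjection_apply_mem _ _)
  have h1 := norm_add_sq_eq_norm_sq_add_norm_sq_real h0
  have h2 := Submodule.norm_sq_eq_add_norm_sq_starProjection x W
  have h3 : ‖((δ : W →L[ℝ] W) (W.orthogonalProjectionOnto x) : V)‖ = ‖W.starProjection x‖ :=
    Unitary.norm_map δ _
  rw [h3] at h1
  rw [← sq_eq_sq₀ (norm_nonneg _) (norm_nonneg _)]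
  linarith

/-- The extension of an orthogonal transformation of a subspace `W` to the whole space by the
identity of `Wᗮ`. -/
noncomputable def extendOrth (W : Submodule ℝ V) (δ : OrthGroup W) : OrthGroup V :=
  Unitary.linearIsometryEquiv.symm <| LinearIsometry.toLinearIsometryEquiv
    { toLinearMap := ((W.subtypeL.comp ((δ : W →L[ℝ] W).comp W.orthogonalProjectionOnto) +
        Wᗮ.starProjection : V →L[ℝ] V) : V →ₗ[ℝ] V)
      norm_map' := norm_extendOrth W δ } rfl

theorem coe_extendOrth (W : Submodule ℝ V) (δ : OrthGroup W) :
    (extendOrth W δ : V →L[ℝ] V) =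
      W.subtypeL.comp ((δ : W →L[ℝ] W).comp W.orthogonalProjectionOnto) + Wᗮ.starProjection :=
  rfl

theorem continuous_extendOrth (W : Submodule ℝ V) : Continuous (extendOrth W) := by
  refine Continuous.subtype_mk (f := fun δ : OrthGroup W => W.subtypeL.comp
    ((δ : W →L[ℝ] W).comp W.orthogonalProjectionOnto) + Wᗮ.starProjection) ?_ _
  exact (continuous_const.clm_comp (continuous_subtype_val.clm_comp continuous_const)).add
    continuous_const

theorem extendOrth_apply_coe (W : Submodule ℝ V) (δ : OrthGroup W) (x : W) :
    (extendOrth W δ : V →L[ℝ] V) x = (δ : W →L[ℝ] W) x := by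
  have h : Wᗮ.starProjection (x : V) = 0 := by
    rw [Submodule.starProjection_apply_eq_zero_iff, Submodule.orthogonal_orthogonal]
    exact x.2
  rw [coe_extendOrth, add_apply, h, add_zero]
  simp

theorem extendOrth_apply_of_mem_orthogonal (W : Submodule ℝ V) (δ : OrthGroup W) {x : V}
    (hx : x ∈ Wᗮ) : (extendOrth W δ : V →L[ℝ] V) x = x := by
  have h : W.orthogonalProjectionOnto x = 0 :=
    Submodule.orthogonalProjectionOnto_eq_zero_iff.mpr hx
  have h' : Wᗮ.starProjection x = x := Submodule.starProjection_eq_self_iff.mpr hx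
  rw [coe_extendOrth, add_apply, h']
  simp [h]

namespace LinGr

theorem lift_rotate (W : Submodule ℝ V) (δ : OrthGroup W) (ξ : LinGr W j) :
    (rotate δ ξ).lift = rotate (extendOrth W δ) ξ.lift := by
  ext x
  constructor
  · rintro ⟨_, ⟨y, hy, rfl⟩, rfl⟩
    exact ⟨_, ⟨y, hy, rfl⟩, extendOrth_apply_coe W δ y⟩
  · rintro ⟨_, ⟨y, hy, rfl⟩, rfl⟩
    exact ⟨_, ⟨y, hy, rfl⟩, (extendOrth_apply_coe W δ y).symm⟩

theorem rotate_extendOrth (W : Submodule ℝ V) (δ : OrthGroup W) {η : LinGr V k}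
    (hη : η.space ≤ Wᗮ) : rotate (extendOrth W δ) η = η := by
  ext x
  constructor
  · rintro ⟨y, hy, rfl⟩
    have h := extendOrth_apply_of_mem_orthogonal W δ (hη hy)
    change (extendOrth W δ : V →L[ℝ] V) y ∈ _
    rw [h]
    exact hy
  · intro hx
    exact ⟨x, hx, extendOrth_apply_of_mem_orthogonal W δ (hη hx)⟩

omit [FiniteDimensional ℝ V] in
theorem exists_lift_eq {W : Submodule ℝ V} {ξ : LinGr V j} (h : ξ.space ≤ W) :
    ∃ ξ' : LinGr W j, ξ'.lift = ξ := by
  have hmap : (ξ.space.comap W.subtype).map W.subtype = ξ.space := by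
    rw [Submodule.map_comap_subtype, inf_eq_right.mpr h]
  have hfin : finrank ℝ (ξ.space.comap W.subtype) = j := by
    rw [(Submodule.equivMapOfInjective W.subtype W.injective_subtype _).finrank_eq, hmap,
      ξ.finrank_eq]
  exact ⟨⟨ξ.space.comap W.subtype, hfin⟩, LinGr.ext hmap⟩

/-- The orthogonal group commutes with the passage to orthogonal complements. -/
theorem orthogonal_rotate (γ : OrthGroup V) (η : LinGr V k) :
    (rotate γ η).spaceᗮ =
      η.spaceᗮ.map (Unitary.linearIsometryEquiv γ).toLinearEquiv.toLinearMap :=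
  (Submodule.map_orthogonal_equiv η.space (Unitary.linearIsometryEquiv γ)).symm

/-- The invariant probability measure of `G_j(W)`, regarded as a measure on `G_j(V)`. -/
noncomputable def probOn (W : Submodule ℝ V) (j : ℕ) : Measure (LinGr V j) :=
  (prob W j).map lift

instance (W : Submodule ℝ V) : IsFiniteMeasure (probOn W j) := by
  unfold probOn
  infer_instance

theorem lintegral_probOn (W : Submodule ℝ V) {F : LinGr V j → ℝ≥0∞} (hF : Measurable F) :
    ∫⁻ ξ, F ξ ∂probOn W j = ∫⁻ ξ : LinGr W j, F ξ.lift ∂prob W j :=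
  lintegral_map hF (continuous_lift W).measurable

theorem probOn_map (γ : OrthGroup V) (W : Submodule ℝ V) :
    probOn (W.map (Unitary.linearIsometryEquiv γ).toLinearEquiv.toLinearMap) j =
      (probOn W j).map (rotate γ) := by
  let e : W ≃ₗᵢ[ℝ] W.map (Unitary.linearIsometryEquiv γ).toLinearEquiv.toLinearMap :=
    (Unitary.linearIsometryEquiv γ).submoduleMap W
  have h : (lift : LinGr (W.map (Unitary.linearIsometryEquiv γ).toLinearEquiv.toLinearMap) j →
      LinGr V j) ∘ mapIso e = rotate γ ∘ lift := by
    funext ξ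
    ext x
    constructor
    · rintro ⟨_, ⟨y, hy, rfl⟩, rfl⟩
      exact ⟨_, ⟨y, hy, rfl⟩, rfl⟩
    · rintro ⟨_, ⟨y, hy, rfl⟩, rfl⟩
      exact ⟨_, ⟨y, hy, rfl⟩, rfl⟩
  rw [probOn, probOn, Measure.map_map (continuous_rotate_right γ).measurable
    (continuous_lift W).measurable, ← h, ← Measure.map_map (continuous_lift _).measurable
    (continuous_mapIso e).measurable]
  exact congrArg (Measure.map lift) (map_mapIso_prob e).symm

theorem probOn_orthogonal_rotate (γ : OrthGroup V) (η : LinGr V k) :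
    probOn (rotate γ η).spaceᗮ j = (probOn η.spaceᗮ j).map (rotate γ) := by
  rw [orthogonal_rotate, probOn_map]

/-- Integration over the subspaces of `ηᗮ` depends measurably on `η`. -/
theorem measurable_lintegral_probOn {Y : Type*} [TopologicalSpace Y] [PolishSpace Y]
    [MeasurableSpace Y] [BorelSpace Y] {F : (LinGr V k × LinGr V j) × Y → ℝ≥0∞}
    (hF : Measurable F) :
    Measurable fun p : LinGr V k × Y => ∫⁻ ξ, F ((p.1, ξ), p.2) ∂probOn p.1.spaceᗮ j := by
  rcases isEmpty_or_nonempty (LinGr V k) with h | ⟨⟨η⟩⟩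
  · exact measurable_of_empty _
  · refine measurable_of_comp_rotate η ?_
    have h : ∀ p : OrthGroup V × Y,
        ∫⁻ ξ, F ((rotate p.1 η, ξ), p.2) ∂probOn (rotate p.1 η).spaceᗮ j =
          ∫⁻ ξ, F ((rotate p.1 η, rotate p.1 ξ), p.2) ∂probOn η.spaceᗮ j := fun p => by
      rw [probOn_orthogonal_rotate, lintegral_map (by fun_prop)
        (continuous_rotate_right p.1).measurable]
    simp_rw [h]
    refine Measurable.lintegral_prod_right' (f := fun q : (OrthGroup V × Y) × LinGr V j =>
      F ((rotate q.1.1 η, rotate q.1.1 q.2), q.1.2)) (hF.comp ?_)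
    have h1 := (continuous_rotate_uncurry (V := V) (j := j)).measurable
    have h2 := (continuous_rotate η).measurable
    exact ((h2.comp (measurable_fst.comp measurable_fst)).prodMk
      (h1.comp ((measurable_fst.comp measurable_fst).prodMk measurable_snd))).prodMk
      (measurable_snd.comp measurable_fst)

/-- A random `k`-subspace `η` followed by a random `j`-subspace of `ηᗮ` has the same law as a
random rotation of a fixed orthogonal pair. As the right-hand side is symmetric in the two
subspaces, so is the left-hand side. -/
theorem lintegral_prob_probOn {η₀ : LinGr V k} {ξ₀ : LinGr V j} (h₀ : ξ₀.space ≤ η₀.spaceᗮ)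
    {F : LinGr V k × LinGr V j → ℝ≥0∞} (hF : Measurable F) :
    ∫⁻ η, ∫⁻ ξ, F (η, ξ) ∂probOn η.spaceᗮ j ∂prob V k =
      ∫⁻ γ, F (rotate γ η₀, rotate γ ξ₀) ∂orthHaar V := by
  set W := η₀.spaceᗮ with hW
  obtain ⟨ξ₁, rfl⟩ := exists_lift_eq h₀
  have hm : Measurable fun η : LinGr V k => ∫⁻ ξ, F (η, ξ) ∂probOn η.spaceᗮ j :=
    (measurable_lintegral_probOn (Y := ℝ) (F := fun p => F p.1) (hF.comp measurable_fst)).comp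
      (measurable_id.prodMk (measurable_const (a := (0 : ℝ))))
  have hr := (continuous_rotate_uncurry (V := V) (j := j)).measurable
  have hrk := (continuous_rotate η₀).measurable
  have hE := (continuous_extendOrth W).measurable
  have hG : Measurable fun γ => F (rotate γ η₀, rotate γ ξ₁.lift) :=
    hF.comp (hrk.prodMk (continuous_rotate ξ₁.lift).measurable)
  -- `δ ∈ O(W)` fixes `η₀`, so that `γ δ` moves the pair as `γ` and `δ` move its two members.
  have h1 : ∀ γ : OrthGroup V, ∫⁻ ξ, F (rotate γ η₀, ξ) ∂probOn (rotate γ η₀).spaceᗮ j =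
      ∫⁻ δ, F (rotate (γ * extendOrth W δ) η₀, rotate (γ * extendOrth W δ) ξ₁.lift)
        ∂orthHaar W := fun γ => by
    rw [probOn_orthogonal_rotate, lintegral_map (by fun_prop)
      (continuous_rotate_right γ).measurable, lintegral_probOn _ (by
        exact hF.comp (measurable_const.prodMk (continuous_rotate_right γ).measurable)),
      lintegral_prob ξ₁]
    · refine lintegral_congr fun δ => ?_
      rw [rotate_mul, rotate_mul, rotate_extendOrth W δ (Submodule.le_orthogonal_orthogonal _),
        lift_rotate]
    · exact hF.comp (measurable_const.prodMk
        ((continuous_rotate_right γ).comp (continuous_lift W)).measurable)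
  rw [lintegral_prob η₀ hm]
  simp_rw [h1]
  rw [lintegral_lintegral_swap]
  · have h2 : ∀ δ : OrthGroup W,
        ∫⁻ γ, F (rotate (γ * extendOrth W δ) η₀, rotate (γ * extendOrth W δ) ξ₁.lift)
          ∂orthHaar V = ∫⁻ γ, F (rotate γ η₀, rotate γ ξ₁.lift) ∂orthHaar V := fun δ =>
      lintegral_mul_right_eq_self (fun γ => F (rotate γ η₀, rotate γ ξ₁.lift)) _
    simp_rw [h2]
    simp
  · exact (hG.comp (measurable_fst.mul (hE.comp measurable_snd))).aemeasurable

end LinGr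

end Flags

end MixedRadon

/-! ### Duality of the mixed Radon transforms -/

namespace MixedRadon

section Duality

variable {V : Type*} [NormedAddCommGroup V] [InnerProductSpace ℝ V] [FiniteDimensional ℝ V]
  {j k : ℕ}

instance : PolishSpace (LinGr V j) :=
  (LinGr.continuous_proj.isClosedEmbedding LinGr.proj_injective).polishSpace

namespace AffGr

theorem continuous_dir_foot : Continuous fun τ : AffGr V j => (τ.dir, τ.foot) :=
  continuous_induced_dom

theorem mk'_add (ξ : LinGr V j) {u : V} (hu : u ∈ ξ.space) (x : V) :
    mk' ξ (u + x) = mk' ξ x := by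
  ext1
  have hm : x ∈ AffineSubspace.mk' (u + x) ξ.space := by
    rw [AffineSubspace.mem_mk', vsub_eq_sub, sub_add_cancel_right]
    exact neg_mem hu
  have hm' := AffineSubspace.mk'_eq hm
  rw [AffineSubspace.direction_mk'] at hm'
  exact hm'.symm

theorem foot_mk'_of_mem (ξ : LinGr V j) {x : V} (hx : x ∈ ξ.spaceᗮ) : (mk' ξ x).foot = x := by
  have h : ξ.proj x = 0 := (Submodule.starProjection_apply_eq_zero_iff ξ.space).mpr hx
  rw [foot_mk', h, sub_zero]

end AffGr

variable [MeasurableSpace V] [BorelSpace V]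

/-- The Lebesgue measure of a subspace, regarded as a measure on the whole space. -/
noncomputable def subVol (K : Submodule ℝ V) : Measure V := (volume : Measure K).map (↑)

instance (K : Submodule ℝ V) : SFinite (subVol K) := by
  unfold subVol
  infer_instance

theorem measurableEmbedding_coe (K : Submodule ℝ V) : MeasurableEmbedding ((↑) : K → V) :=
  MeasurableEmbedding.subtype_coe K.closed_of_finiteDimensional.measurableSet

theorem lintegral_subVol (K : Submodule ℝ V) (F : V → ℝ≥0∞) :
    ∫⁻ x, F x ∂subVol K = ∫⁻ x : K, F x :=
  (measurableEmbedding_coe K).lintegral_map F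

theorem ae_subVol_mem (K : Submodule ℝ V) : ∀ᵐ x ∂subVol K, x ∈ K := by
  rw [subVol, (measurableEmbedding_coe K).ae_map_iff]
  exact Filter.Eventually.of_forall fun x => x.2

theorem subVol_map (γ : OrthGroup V) (K : Submodule ℝ V) :
    subVol (K.map (Unitary.linearIsometryEquiv γ).toLinearEquiv.toLinearMap) =
      (subVol K).map (γ : V →L[ℝ] V) := by
  let e : K ≃ₗᵢ[ℝ] K.map (Unitary.linearIsometryEquiv γ).toLinearEquiv.toLinearMap :=
    (Unitary.linearIsometryEquiv γ).submoduleMap K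
  rw [subVol, subVol, Measure.map_map (by fun_prop) (by fun_prop),
    ← e.measurePreserving.map_eq, Measure.map_map (by fun_prop) e.continuous.measurable]
  rfl

/-- Lebesgue measure is the product of the Lebesgue measures of a subspace and of its orthogonal
complement. -/
theorem lintegral_subVol_subVol (K : Submodule ℝ V) {F : V → ℝ≥0∞} (hF : Measurable F) :
    ∫⁻ v, ∫⁻ u, F (u + v) ∂subVol K ∂subVol Kᗮ = ∫⁻ x, F x := by
  have e := K.measurePreserving_measurableEquivProd (0 : V)
  rw [InnerProductSpace.euclideanHausdorffMeasure_eq_volume] at e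
  rw [← e.symm.lintegral_comp hF, Measure.volume_eq_prod, lintegral_prod_symm _ (by fun_prop),
    lintegral_subVol]
  refine lintegral_congr fun v => ?_
  rw [lintegral_subVol]
  refine lintegral_congr fun u => ?_
  rw [Submodule.measurableEquivProd_symm_apply, vadd_eq_add, add_zero]

/-- Integration over a variable subspace depends measurably on the subspace. -/
theorem measurable_lintegral_subVol {Y : Type*} [TopologicalSpace Y] [PolishSpace Y]
    [MeasurableSpace Y] [BorelSpace Y] {F : V × Y → ℝ≥0∞} (hF : Measurable F) :
    Measurable fun p : LinGr V k × Y => ∫⁻ u, F (u, p.2) ∂subVol p.1.space := by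
  rcases isEmpty_or_nonempty (LinGr V k) with h | ⟨⟨η⟩⟩
  · exact measurable_of_empty _
  · refine LinGr.measurable_of_comp_rotate η ?_
    have h : ∀ p : OrthGroup V × Y,
        ∫⁻ u, F (u, p.2) ∂subVol (LinGr.rotate p.1 η).space =
          ∫⁻ u, F ((p.1 : V →L[ℝ] V) u, p.2) ∂subVol η.space := fun p => by
      change ∫⁻ u, F (u, p.2) ∂subVol
        (η.space.map (Unitary.linearIsometryEquiv p.1).toLinearEquiv.toLinearMap) = _
      rw [subVol_map, lintegral_map (by fun_prop) (by fun_prop)]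
    simp_rw [h]
    refine Measurable.lintegral_prod_right' (f := fun q : (OrthGroup V × Y) × V =>
      F ((q.1.1 : V →L[ℝ] V) q.2, q.1.2)) (hF.comp ?_)
    have hc : Continuous fun q : (OrthGroup V × Y) × V => (q.1.1 : V →L[ℝ] V) q.2 :=
      (continuous_subtype_val.comp (continuous_fst.comp continuous_fst)).clm_apply continuous_snd
    have hc' : Continuous fun q : OrthGroup V × V => (q.1 : V →L[ℝ] V) q.2 :=
      (continuous_subtype_val.comp continuous_fst).clm_apply continuous_snd
    exact (hc'.measurable.comp ((measurable_fst.comp measurable_fst).prodMk measurable_snd)).prodMk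
      (measurable_snd.comp measurable_fst)

theorem mixedRadon_eq {f : AffGr V j → ℝ≥0∞} (hf : Measurable f) (ζ : AffGr V k) :
    mixedRadon f ζ = ∫⁻ ξ, ∫⁻ u, f (AffGr.mk' ξ (u + ζ.foot)) ∂subVol ζ.dir.space
      ∂LinGr.probOn ζ.dir.spaceᗮ j := by
  have hm : Measurable fun p : LinGr V j × V => f (AffGr.mk' p.1 (p.2 + ζ.foot)) :=
    hf.comp (AffGr.continuous_mk'.measurable.comp
      (measurable_fst.prodMk (measurable_snd.add_const _)))
  rw [mixedRadon, lintegral_incidenceMeasure ζ hf,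
    LinGr.lintegral_probOn _ hm.lintegral_prod_right']
  simp_rw [lintegral_subVol]

theorem measurable_mixedRadon {f : AffGr V j → ℝ≥0∞} (hf : Measurable f) :
    Measurable (mixedRadon f : AffGr V k → ℝ≥0∞) := by
  have h1 : Measurable fun p : LinGr V k × (LinGr V j × V) =>
      ∫⁻ u, f (AffGr.mk' p.2.1 (u + p.2.2)) ∂subVol p.1.space :=
    measurable_lintegral_subVol (F := fun q : V × (LinGr V j × V) =>
      f (AffGr.mk' q.2.1 (q.1 + q.2.2))) (hf.comp (AffGr.continuous_mk'.measurable.comp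
        ((measurable_fst.comp measurable_snd).prodMk
          (measurable_fst.add (measurable_snd.comp measurable_snd)))))
  have h2 : Measurable fun p : LinGr V k × V =>
      ∫⁻ ξ, ∫⁻ u, f (AffGr.mk' ξ (u + p.2)) ∂subVol p.1.space ∂LinGr.probOn p.1.spaceᗮ j :=
    LinGr.measurable_lintegral_probOn (F := fun q : (LinGr V k × LinGr V j) × V =>
      ∫⁻ u, f (AffGr.mk' q.1.2 (u + q.2)) ∂subVol q.1.1.space) (h1.comp
        ((measurable_fst.comp measurable_fst).prodMk
          ((measurable_snd.comp measurable_fst).prodMk measurable_snd)))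
  have h3 : (mixedRadon f : AffGr V k → ℝ≥0∞) = (fun p : LinGr V k × V =>
      ∫⁻ ξ, ∫⁻ u, f (AffGr.mk' ξ (u + p.2)) ∂subVol p.1.space ∂LinGr.probOn p.1.spaceᗮ j) ∘
        fun ζ => (ζ.dir, ζ.foot) := funext fun ζ => mixedRadon_eq hf ζ
  rw [h3]
  exact h2.comp AffGr.continuous_dir_foot.measurable

/-- The pairing of `φ` with the transform of `f` as an integral over incident perpendicular planes
`η + x` and `ξ + x`, in which `f` and `φ` play the same role. -/
theorem lintegral_mul_mixedRadon {f : AffGr V j → ℝ≥0∞} (hf : Measurable f)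
    {φ : AffGr V k → ℝ≥0∞} (hφ : Measurable φ) :
    ∫⁻ ζ, φ ζ * mixedRadon f ζ ∂affVolume V k =
      ∫⁻ η, ∫⁻ ξ, ∫⁻ x : V, φ (AffGr.mk' η x) * f (AffGr.mk' ξ x) ∂volume
        ∂LinGr.probOn η.spaceᗮ j ∂LinGr.prob V k := by
  rw [lintegral_affVolume (f := fun ζ => φ ζ * mixedRadon f ζ)
    (hφ.mul (measurable_mixedRadon hf))]
  refine lintegral_congr fun η => ?_
  have hφη : Measurable fun x => φ (AffGr.mk' η x) := hφ.comp (measurable_mk'_right η)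
  have hfm : Measurable fun p : LinGr V j × V => f (AffGr.mk' p.1 p.2) :=
    hf.comp AffGr.continuous_mk'.measurable
  have hG : Measurable fun p : V × LinGr V j =>
      ∫⁻ u, f (AffGr.mk' p.2 (u + p.1)) ∂subVol η.space :=
    Measurable.lintegral_prod_right' (f := fun q : (V × LinGr V j) × V =>
      f (AffGr.mk' q.1.2 (q.2 + q.1.1))) (hfm.comp
        ((measurable_snd.comp measurable_fst).prodMk
          (measurable_snd.add (measurable_fst.comp measurable_fst))))
  calc ∫⁻ v : ↥(η.spaceᗮ), φ (AffGr.mk' η v) * mixedRadon f (AffGr.mk' η (v : V))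
      = ∫⁻ v : ↥(η.spaceᗮ), φ (AffGr.mk' η v) *
          ∫⁻ ξ, ∫⁻ u, f (AffGr.mk' ξ (u + v)) ∂subVol η.space ∂LinGr.probOn η.spaceᗮ j := by
        refine lintegral_congr fun v => ?_
        rw [mixedRadon_eq hf, AffGr.dir_mk', AffGr.foot_mk'_of_mem η v.2]
    _ = ∫⁻ v, φ (AffGr.mk' η v) * ∫⁻ ξ, ∫⁻ u, f (AffGr.mk' ξ (u + v)) ∂subVol η.space
          ∂LinGr.probOn η.spaceᗮ j ∂subVol η.spaceᗮ :=
        (lintegral_subVol _ fun v => φ (AffGr.mk' η v) *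
          ∫⁻ ξ, ∫⁻ u, f (AffGr.mk' ξ (u + v)) ∂subVol η.space ∂LinGr.probOn η.spaceᗮ j).symm
    _ = ∫⁻ v, ∫⁻ ξ, φ (AffGr.mk' η v) * ∫⁻ u, f (AffGr.mk' ξ (u + v)) ∂subVol η.space
          ∂LinGr.probOn η.spaceᗮ j ∂subVol η.spaceᗮ := by
        refine lintegral_congr fun v => (lintegral_const_mul _ ?_).symm
        exact hG.comp (measurable_const.prodMk measurable_id)
    _ = ∫⁻ ξ, ∫⁻ v, φ (AffGr.mk' η v) * ∫⁻ u, f (AffGr.mk' ξ (u + v)) ∂subVol η.space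
          ∂subVol η.spaceᗮ ∂LinGr.probOn η.spaceᗮ j :=
        lintegral_lintegral_swap ((hφη.comp measurable_fst).mul hG).aemeasurable
    _ = _ := by
        refine lintegral_congr fun ξ => ?_
        have hfξ : Measurable fun x => f (AffGr.mk' ξ x) := hf.comp (measurable_mk'_right ξ)
        rw [← lintegral_subVol_subVol η.space
          (F := fun x => φ (AffGr.mk' η x) * f (AffGr.mk' ξ x)) (hφη.mul hfξ)]
        refine lintegral_congr fun v => ?_
        have hfv : Measurable fun u => f (AffGr.mk' ξ (u + v)) :=
          hfξ.comp (measurable_add_const v)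
        rw [← lintegral_const_mul _ hfv]
        refine lintegral_congr_ae ?_
        filter_upwards [ae_subVol_mem η.space] with u hu
        rw [AffGr.mk'_add η hu]

/-- The transforms from `j`-planes to `k`-planes and back are dual to each other. -/
theorem lintegral_mul_mixedRadon_comm (hjk : j + k ≤ finrank ℝ V) {f : AffGr V j → ℝ≥0∞}
    (hf : Measurable f) {φ : AffGr V k → ℝ≥0∞} (hφ : Measurable φ) :
    ∫⁻ ζ, φ ζ * mixedRadon f ζ ∂affVolume V k = ∫⁻ τ, f τ * mixedRadon φ τ ∂affVolume V j := by
  have := LinGr.isProbabilityMeasure_prob (V := V) (j := k) (by omega)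
  obtain ⟨η₀⟩ := nonempty_of_isProbabilityMeasure (LinGr.prob V k)
  have hd := η₀.space.finrank_add_finrank_orthogonal
  rw [η₀.finrank_eq] at hd
  have := LinGr.isProbabilityMeasure_prob (V := ↥(η₀.spaceᗮ)) (j := j) (by omega)
  obtain ⟨ξ₁⟩ := nonempty_of_isProbabilityMeasure (LinGr.prob ↥(η₀.spaceᗮ) j)
  have h : ξ₁.lift.space ≤ η₀.spaceᗮ := Submodule.map_subtype_le _ _
  have h' : η₀.space ≤ ξ₁.lift.spaceᗮ := Submodule.le_orthogonal_iff_le_orthogonal.mp h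
  have hF : Measurable fun p : LinGr V k × LinGr V j =>
      ∫⁻ x : V, φ (AffGr.mk' p.1 x) * f (AffGr.mk' p.2 x) :=
    Measurable.lintegral_prod_right' (f := fun q : (LinGr V k × LinGr V j) × V =>
      φ (AffGr.mk' q.1.1 q.2) * f (AffGr.mk' q.1.2 q.2))
      ((hφ.comp (AffGr.continuous_mk'.measurable.comp
        ((measurable_fst.comp measurable_fst).prodMk measurable_snd))).mul
      (hf.comp (AffGr.continuous_mk'.measurable.comp
        ((measurable_snd.comp measurable_fst).prodMk measurable_snd))))
  rw [lintegral_mul_mixedRadon hf hφ, lintegral_mul_mixedRadon hφ hf,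
    LinGr.lintegral_prob_probOn h hF]
  simp_rw [mul_comm (f _)]
  rw [LinGr.lintegral_prob_probOn h' (F := fun p =>
    ∫⁻ x : V, φ (AffGr.mk' p.2 x) * f (AffGr.mk' p.1 x)) (hF.comp measurable_swap)]

end Duality

end MixedRadon

/-! ### Random subspaces close to a fixed vector -/

namespace MixedRadon

section SmallBall

variable {V : Type*} [NormedAddCommGroup V] [InnerProductSpace ℝ V] [FiniteDimensional ℝ V]
  {j k : ℕ}

/-- The volume of the unit ball of the `m`-dimensional Euclidean space. -/
noncomputable def unitBallVol (m : ℕ) : ℝ≥0∞ :=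
  volume (Metric.closedBall (0 : EuclideanSpace ℝ (Fin m)) 1)

theorem unitBallVol_ne_zero (m : ℕ) : unitBallVol m ≠ 0 :=
  (Metric.measure_closedBall_pos _ _ one_pos).ne'

theorem unitBallVol_ne_top (m : ℕ) : unitBallVol m ≠ ∞ := measure_closedBall_lt_top.ne

theorem exists_orthGroup_apply_eq {x y : V} (h : ‖x‖ = ‖y‖) :
    ∃ γ : OrthGroup V, (γ : V →L[ℝ] V) x = y :=
  ⟨Unitary.linearIsometryEquiv.symm (Submodule.reflection (ℝ ∙ (x - y))ᗮ),
    Submodule.reflection_sub h⟩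

theorem norm_sub_proj_rotate (γ : OrthGroup V) (η : LinGr V k) (x : V) :
    ‖(γ : V →L[ℝ] V) x - (LinGr.rotate γ η).proj ((γ : V →L[ℝ] V) x)‖ = ‖x - η.proj x‖ := by
  rw [LinGr.proj_rotate_apply, ← map_sub, Unitary.norm_map]

theorem continuous_norm_sub_proj :
    Continuous fun p : V × LinGr V k => ‖p.1 - p.2.proj p.1‖ :=
  (continuous_fst.sub
    ((LinGr.continuous_proj.comp continuous_snd).clm_apply continuous_fst)).norm

theorem measurableSet_norm_sub_proj_le (x : V) (r : ℝ) :
    MeasurableSet {η : LinGr V k | ‖x - η.proj x‖ ≤ r} :=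
  (isClosed_le (continuous_norm_sub_proj.comp (Continuous.prodMk_right x))
    continuous_const).measurableSet

/-- By rotation invariance and homogeneity, the law of the angle between a random subspace and a
fixed vector does not depend on the vector. -/
theorem prob_norm_sub_proj_congr {x y : V} (hx : x ≠ 0) (hy : y ≠ 0) (ε : ℝ) :
    LinGr.prob V k {η | ‖x - η.proj x‖ ≤ ε * ‖x‖} =
      LinGr.prob V k {η | ‖y - η.proj y‖ ≤ ε * ‖y‖} := by
  have hx' : 0 < ‖x‖ := norm_pos_iff.mpr hx
  have hy' : 0 < ‖y‖ := norm_pos_iff.mpr hy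
  have hn : ‖x‖ = ‖(‖x‖ / ‖y‖) • y‖ := by
    rw [norm_smul, Real.norm_of_nonneg (by positivity), div_mul_cancel₀ _ hy'.ne']
  obtain ⟨γ, hγ⟩ := exists_orthGroup_apply_eq hn
  conv_rhs => rw [← LinGr.map_rotate_prob γ]
  rw [Measure.map_apply (LinGr.continuous_rotate_right γ).measurable
    (measurableSet_norm_sub_proj_le _ _)]
  congr 1
  ext η
  have h1 : ‖x - η.proj x‖ = ‖x‖ / ‖y‖ * ‖y - (LinGr.rotate γ η).proj y‖ := by
    rw [← norm_sub_proj_rotate γ, hγ, map_smul, ← smul_sub, norm_smul,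
      Real.norm_of_nonneg (by positivity)]
  simp only [Set.mem_ofPred_eq, Set.mem_preimage]
  rw [h1, div_mul_eq_mul_div, div_le_iff₀ hy', mul_right_comm, mul_comm ‖x‖,
    mul_le_mul_iff_left₀ hx']

theorem LinGr.prob_univ_le_one : LinGr.prob V k Set.univ ≤ 1 := by
  rcases isEmpty_or_nonempty (LinGr V k) with h | ⟨⟨ξ⟩⟩
  · rw [Set.univ_eq_empty_iff.mpr h, measure_empty]
    exact zero_le_one
  · have := LinGr.isProbabilityMeasure_prob (ξ.finrank_eq.symm.trans_le (Submodule.finrank_le _))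
    exact prob_le_one

theorem AffGr.absDist_mk' (ξ : LinGr V j) (x : V) : (AffGr.mk' ξ x).absDist = ‖x - ξ.proj x‖ := by
  rw [AffGr.absDist_eq_norm_foot, AffGr.foot_mk']

theorem LinGr.proj_lift_apply {W : Submodule ℝ V} (η : LinGr W k) (w : W) :
    η.lift.proj (w : V) = (η.proj w : V) := by
  refine (Submodule.eq_starProjection_of_mem_of_inner_eq_zero (K := η.lift.space)
    (u := (w : V)) ?_ ?_)
  · exact Submodule.mem_map_of_mem (Submodule.starProjection_apply_mem η.space w)
  · rintro _ ⟨y, hy, rfl⟩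
    exact Submodule.starProjection_inner_eq_zero w y hy

theorem AffGr.absDist_mk'_lift {W : Submodule ℝ V} (η : LinGr W k) {v : V} (hv : v ∈ Wᗮ) (w : W) :
    (AffGr.mk' η.lift (v + w)).absDist = √(‖v‖ ^ 2 + ‖w - η.proj w‖ ^ 2) := by
  have h0 : η.lift.proj v = 0 := (Submodule.starProjection_apply_eq_zero_iff η.lift.space).mpr
    (Submodule.orthogonal_le (Submodule.map_subtype_le W η.space) hv)
  have h1 : inner ℝ v ((w - η.proj w : W) : V) = 0 :=
    Submodule.inner_left_of_mem_orthogonal (Subtype.coe_prop _) hv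
  have h2 := norm_add_sq_eq_norm_sq_add_norm_sq_real h1
  rw [AffGr.absDist_mk', map_add, h0, LinGr.proj_lift_apply, zero_add, add_sub_assoc,
    ← AddSubgroupClass.coe_sub, Submodule.coe_norm, sq, sq, ← h2,
    Real.sqrt_mul_self (norm_nonneg _)]

variable [MeasurableSpace V] [BorelSpace V]

theorem volume_closedBall_eq_unitBallVol (K : Submodule ℝ V) {r : ℝ} (hr : 0 ≤ r) :
    volume (Metric.closedBall (0 : K) r) =
      ENNReal.ofReal (r ^ finrank ℝ K) * unitBallVol (finrank ℝ K) := by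
  rw [Measure.addHaar_closedBall' _ _ hr]
  congr 1
  exact volume_unitBall_eq ⟨K, rfl⟩

theorem volume_unitBall_eq_unitBallVol :
    volume (Metric.closedBall (0 : V) 1) = unitBallVol (finrank ℝ V) := by
  have h := (stdOrthonormalBasis ℝ V).measurePreserving_repr.measure_preimage
    (s := Metric.closedBall 0 1) Metric.isClosed_closedBall.measurableSet.nullMeasurableSet
  rw [unitBallVol, ← h]
  congr 1
  ext x
  simp

/-- The part of the unit ball within distance `ε` of a `k`-dimensional subspace lies in a product
of balls of radii `1` and `ε`. -/
theorem volume_unitBall_inter_slab_le (η : LinGr V k) {ε : ℝ} (hε : 0 ≤ ε) :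
    volume {x : V | ‖x‖ ≤ 1 ∧ ‖x - η.proj x‖ ≤ ε} ≤
      ENNReal.ofReal (ε ^ (finrank ℝ V - k)) *
        (unitBallVol k * unitBallVol (finrank ℝ V - k)) := by
  have e := η.space.measurePreserving_measurableEquivProd (0 : V)
  rw [InnerProductSpace.euclideanHausdorffMeasure_eq_volume] at e
  rw [← e.symm.measure_preimage_equiv]
  have hsub : (η.space.measurableEquivProd (0 : V)).symm ⁻¹'
      {x : V | ‖x‖ ≤ 1 ∧ ‖x - η.proj x‖ ≤ ε} ⊆
        Metric.closedBall (0 : η.space) 1 ×ˢ Metric.closedBall (0 : ↥(η.spaceᗮ)) ε := by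
    rintro ⟨w, u⟩ h
    have hw : η.proj (w : V) = w := Submodule.starProjection_eq_self_iff.mpr w.2
    have hu : η.proj (u : V) = 0 :=
      (Submodule.starProjection_apply_eq_zero_iff η.space).mpr u.2
    simp only [Set.mem_preimage, Submodule.measurableEquivProd_symm_apply, vadd_eq_add, add_zero,
      Set.mem_ofPred_eq, map_add, hw, hu, add_sub_cancel_left] at h
    simp only [Set.mem_prod, mem_closedBall_zero_iff]
    refine ⟨?_, h.2⟩
    have h0 : inner ℝ (w : V) (u : V) = 0 := Submodule.inner_right_of_mem_orthogonal w.2 u.2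
    have h1 := norm_add_sq_eq_norm_sq_add_norm_sq_real h0
    refine le_trans ?_ h.1
    rw [Submodule.coe_norm]
    nlinarith [norm_nonneg (w : V), norm_nonneg (u : V), norm_nonneg ((w : V) + u)]
  refine (measure_mono hsub).trans_eq ?_
  have hd := η.space.finrank_add_finrank_orthogonal
  rw [η.finrank_eq] at hd
  have hd' : finrank ℝ ↥(η.spaceᗮ) = finrank ℝ V - k := by omega
  rw [Measure.volume_eq_prod, Measure.prod_prod, volume_closedBall_eq_unitBallVol _ hε,
    volume_closedBall_eq_unitBallVol _ zero_le_one, η.finrank_eq, hd', one_pow, ENNReal.ofReal_one,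
    one_mul]
  ring

/-- The probability that a random `k`-dimensional subspace passes within distance `ε ‖w‖` of a
fixed vector `w` is at most of order `ε ^ (dim V - k)`. It does not depend on `w`, so that it may be
averaged over the unit ball, where the volume of a neighbourhood of a single subspace bounds it. -/
theorem prob_norm_sub_proj_le {w : V} (hw : w ≠ 0) {ε : ℝ} (hε : 0 ≤ ε) :
    LinGr.prob V k {η | ‖w - η.proj w‖ ≤ ε * ‖w‖} ≤
      ENNReal.ofReal (ε ^ (finrank ℝ V - k)) *
        (unitBallVol k * unitBallVol (finrank ℝ V - k) / unitBallVol (finrank ℝ V)) := by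
  set q := LinGr.prob V k {η | ‖w - η.proj w‖ ≤ ε * ‖w‖} with hq
  have : Nontrivial V := ⟨w, 0, hw⟩
  let S : Set (V × LinGr V k) := {p | ‖p.1‖ ≤ 1 ∧ ‖p.1 - p.2.proj p.1‖ ≤ ε * ‖p.1‖}
  have hc := continuous_norm_sub_proj (V := V) (k := k)
  have hn : Continuous fun p : V × LinGr V k => ‖p.1‖ := continuous_fst.norm
  have hS1 : IsClosed {p : V × LinGr V k | ‖p.1‖ ≤ 1} := isClosed_le hn continuous_const
  have hS2 : IsClosed {p : V × LinGr V k | ‖p.1 - p.2.proj p.1‖ ≤ ε * ‖p.1‖} :=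
    isClosed_le hc (continuous_const.mul hn)
  have hS : MeasurableSet S := (hS1.inter hS2).measurableSet
  have h1 : q * unitBallVol (finrank ℝ V) ≤ (volume.prod (LinGr.prob V k)) S := by
    rw [Measure.prod_apply hS, ← volume_unitBall_eq_unitBallVol,
      ← lintegral_indicator_const Metric.isClosed_closedBall.measurableSet]
    refine lintegral_mono_ae ?_
    filter_upwards [Measure.ae_ne volume (0 : V)] with x hx
    by_cases hx1 : x ∈ Metric.closedBall (0 : V) 1
    · rw [Set.indicator_of_mem hx1, hq, prob_norm_sub_proj_congr hw hx]
      have hsub : {η : LinGr V k | ‖x - η.proj x‖ ≤ ε * ‖x‖} ⊆ Prod.mk x ⁻¹' S :=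
        fun η hη => ⟨mem_closedBall_zero_iff.mp hx1, hη⟩
      exact measure_mono hsub
    · rw [Set.indicator_of_notMem hx1]
      exact zero_le
  have h2 : (volume.prod (LinGr.prob V k)) S ≤ ENNReal.ofReal (ε ^ (finrank ℝ V - k)) *
      (unitBallVol k * unitBallVol (finrank ℝ V - k)) := by
    rw [Measure.prod_apply_symm hS]
    calc _ ≤ ∫⁻ _ : LinGr V k, ENNReal.ofReal (ε ^ (finrank ℝ V - k)) *
          (unitBallVol k * unitBallVol (finrank ℝ V - k)) ∂LinGr.prob V k := by
          refine lintegral_mono fun η => (measure_mono (?_ : _ ⊆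
            {x : V | ‖x‖ ≤ 1 ∧ ‖x - η.proj x‖ ≤ ε})).trans
            (volume_unitBall_inter_slab_le η hε)
          rintro x ⟨hx1, hx2⟩
          exact ⟨hx1, hx2.trans (mul_le_of_le_one_right hε hx1)⟩
      _ ≤ _ := by
          rw [lintegral_const]
          exact mul_le_of_le_one_right zero_le LinGr.prob_univ_le_one
  rw [← mul_div_assoc]
  exact (ENNReal.le_div_iff_mul_le (Or.inl (unitBallVol_ne_zero _))
    (Or.inl (unitBallVol_ne_top _))).mpr (h1.trans h2)

/-! ### The dual transform of the indicator function of a ball -/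

/-- The transform of a radial function. For `ζ = η + v` and `ξ ≤ ηᗮ`, `u ∈ η`, the vector `u` is
orthogonal to the component of `v` in `ξᗮ`, and their sum is the foot of `ξ + u + v`. -/
theorem lintegral_incidenceMeasure_absDist (ζ : AffGr V k) {g : ℝ → ℝ≥0∞} (hg : Measurable g) :
    mixedRadon (fun τ : AffGr V j => g τ.absDist) ζ =
      ∫⁻ ξ : LinGr ↥(ζ.dir.spaceᗮ) j, ∫⁻ u : ζ.dir.space,
        g √(‖u‖ ^ 2 + ‖(⟨ζ.foot, ζ.foot_mem⟩ : ↥(ζ.dir.spaceᗮ)) -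
          ξ.proj ⟨ζ.foot, ζ.foot_mem⟩‖ ^ 2) ∂volume ∂LinGr.prob ↥(ζ.dir.spaceᗮ) j := by
  rw [mixedRadon, lintegral_incidenceMeasure ζ (f := fun τ => g τ.absDist)
    (hg.comp AffGr.continuous_absDist.measurable)]
  refine lintegral_congr fun ξ => lintegral_congr fun u => ?_
  have h := AffGr.absDist_mk'_lift ξ (Submodule.le_orthogonal_orthogonal _ u.2)
    ⟨ζ.foot, ζ.foot_mem⟩
  exact congrArg g h

end SmallBall

end MixedRadon

/-! ### Compact sets of planes and finiteness almost everywhere -/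

namespace MixedRadon

section Finiteness

variable {V : Type*} [NormedAddCommGroup V] [InnerProductSpace ℝ V] [FiniteDimensional ℝ V]
  {j k : ℕ}

theorem AffGr.isCompact_absDist_le (a : ℝ) : IsCompact {τ : AffGr V j | τ.absDist ≤ a} := by
  have h : {τ : AffGr V j | τ.absDist ≤ a} ⊆ (fun p : LinGr V j × V => AffGr.mk' p.1 p.2) ''
      (Set.univ ×ˢ Metric.closedBall 0 a) := fun τ hτ =>
    ⟨(τ.dir, τ.foot), ⟨Set.mem_univ _, by
      rw [mem_closedBall_zero_iff, ← AffGr.absDist_eq_norm_foot]; exact hτ⟩, AffGr.mk'_dir_foot τ⟩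
  exact ((isCompact_univ.prod (isCompact_closedBall 0 a)).image
    AffGr.continuous_mk').of_isClosed_subset
      (isClosed_le AffGr.continuous_absDist continuous_const) h

instance : SecondCountableTopology (AffGr V j) :=
  TopologicalSpace.secondCountableTopology_induced _ _ fun τ : AffGr V j => (τ.dir, τ.foot)

variable [MeasurableSpace V] [BorelSpace V]

theorem mixedRadon_ball_le (τ : AffGr V j) {A : ℝ} (hA : 0 ≤ A) :
    mixedRadon (fun ζ : AffGr V k => (Set.Iic A).indicator 1 ζ.absDist) τ ≤
      ENNReal.ofReal (A ^ j) * unitBallVol j * LinGr.prob ↥(τ.dir.spaceᗮ) k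
        {η | ‖(⟨τ.foot, τ.foot_mem⟩ : ↥(τ.dir.spaceᗮ)) - η.proj ⟨τ.foot, τ.foot_mem⟩‖ ≤ A} := by
  set w : ↥(τ.dir.spaceᗮ) := ⟨τ.foot, τ.foot_mem⟩ with hw
  have hB : volume (Metric.closedBall (0 : τ.dir.space) A) =
      ENNReal.ofReal (A ^ j) * unitBallVol j := by
    rw [volume_closedBall_eq_unitBallVol _ hA, τ.dir.finrank_eq]
  have hS : MeasurableSet {η : LinGr ↥(τ.dir.spaceᗮ) k | ‖w - η.proj w‖ ≤ A} :=
    measurableSet_norm_sub_proj_le w A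
  rw [lintegral_incidenceMeasure_absDist τ (g := (Set.Iic A).indicator 1)
    (measurable_one.indicator measurableSet_Iic), ← hB, ← lintegral_indicator_const hS]
  refine lintegral_mono fun η => ?_
  have hle : ∀ u : τ.dir.space, ‖u‖ ≤ √(‖u‖ ^ 2 + ‖w - η.proj w‖ ^ 2) ∧
      ‖w - η.proj w‖ ≤ √(‖u‖ ^ 2 + ‖w - η.proj w‖ ^ 2) := fun u =>
    ⟨Real.le_sqrt_of_sq_le (by nlinarith), Real.le_sqrt_of_sq_le (by nlinarith)⟩
  by_cases hη : η ∈ {η : LinGr ↥(τ.dir.spaceᗮ) k | ‖w - η.proj w‖ ≤ A}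
  · rw [Set.indicator_of_mem hη, ← lintegral_indicator_one
      Metric.isClosed_closedBall.measurableSet]
    refine lintegral_mono fun u => ?_
    by_cases h1 : √(‖u‖ ^ 2 + ‖w - η.proj w‖ ^ 2) ∈ Set.Iic A
    · have h2 : u ∈ Metric.closedBall (0 : τ.dir.space) A :=
        mem_closedBall_zero_iff.mpr ((hle u).1.trans h1)
      exact (Set.indicator_of_mem h1 1).trans_le (Set.indicator_of_mem h2 1).ge
    · exact (Set.indicator_of_notMem h1 1).trans_le zero_le
  · rw [Set.indicator_of_notMem hη]
    refine (lintegral_eq_zero_of_ae_eq_zero (Filter.Eventually.of_forall fun u => ?_)).le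
    refine Set.indicator_of_notMem (fun h => hη ?_) _
    exact (hle u).2.trans h

/-- The dual transform of the indicator function of a ball is bounded. -/
theorem mixedRadon_ball_le_const (τ : AffGr V j) {A : ℝ} (hA : 0 ≤ A) :
    mixedRadon (fun ζ : AffGr V k => (Set.Iic A).indicator 1 ζ.absDist) τ ≤
      ENNReal.ofReal (A ^ j) * unitBallVol j :=
  (mixedRadon_ball_le τ hA).trans (mul_le_of_le_one_right zero_le
    ((measure_mono (Set.subset_univ _)).trans LinGr.prob_univ_le_one))

/-- The dual transform of the indicator function of a ball decays at infinity like the weight of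
the tail condition. -/
theorem exists_mixedRadon_ball_le_zpow (hjk : j + k ≤ finrank ℝ V) {A : ℝ} (hA : 0 ≤ A) :
    ∃ C : ℝ≥0∞, C ≠ ∞ ∧ ∀ τ : AffGr V j, 0 < τ.absDist →
      mixedRadon (fun ζ : AffGr V k => (Set.Iic A).indicator 1 ζ.absDist) τ ≤
        C * ENNReal.ofReal (τ.absDist ^ ((k : ℤ) + j - finrank ℝ V)) := by
  set d := finrank ℝ V - j with hd
  have hz : (k : ℤ) + j - finrank ℝ V = -((d - k : ℕ) : ℤ) := by omega
  refine ⟨ENNReal.ofReal (A ^ j) * unitBallVol j * (ENNReal.ofReal (A ^ (d - k)) *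
    (unitBallVol k * unitBallVol (d - k) / unitBallVol d)), ?_, fun τ hτ => ?_⟩
  · exact ENNReal.mul_ne_top (ENNReal.mul_ne_top ENNReal.ofReal_ne_top (unitBallVol_ne_top _))
      (ENNReal.mul_ne_top ENNReal.ofReal_ne_top (ENNReal.div_ne_top
        (ENNReal.mul_ne_top (unitBallVol_ne_top _) (unitBallVol_ne_top _)) (unitBallVol_ne_zero _)))
  · have hW : finrank ℝ ↥(τ.dir.spaceᗮ) = d := by
      have := τ.dir.space.finrank_add_finrank_orthogonal
      rw [τ.dir.finrank_eq] at this
      omega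
    set w : ↥(τ.dir.spaceᗮ) := ⟨τ.foot, τ.foot_mem⟩ with hw
    have hwn : ‖w‖ = τ.absDist := (AffGr.absDist_eq_norm_foot τ).symm
    have hw0 : w ≠ 0 := norm_pos_iff.mp (hwn ▸ hτ)
    have hA' : A = A / τ.absDist * ‖w‖ := by rw [hwn, div_mul_cancel₀ _ hτ.ne']
    refine (mixedRadon_ball_le τ hA).trans ?_
    rw [mul_assoc (ENNReal.ofReal (A ^ j) * unitBallVol j)]
    gcongr
    rw [← hw]
    conv_lhs => rw [hA']
    refine (prob_norm_sub_proj_le hw0 (by positivity)).trans_eq ?_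
    rw [hW, hz, zpow_neg, zpow_natCast, div_pow, div_eq_mul_inv (A ^ _),
      ENNReal.ofReal_mul (by positivity)]
    ring

/-- A locally integrable function subject to the tail condition has an integrable transform over
every ball, by duality with the indicator function of that ball. -/
theorem lintegral_mul_mixedRadon_ball_lt_top {𝕜 : Type*} [RCLike 𝕜] (hjk : j + k ≤ finrank ℝ V)
    {f : AffGr V j → 𝕜} (hf : LocallyIntegrable f (affVolume V j))
    (ht : TailIntegrable f ((k : ℤ) + j - finrank ℝ V)) {F : AffGr V j → ℝ≥0∞}
    (hF : Measurable F) (hfF : (fun τ => ‖f τ‖ₑ) =ᵐ[affVolume V j] F) {A : ℝ} (hA : 0 ≤ A) :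
    ∫⁻ ζ : AffGr V k, (Set.Iic A).indicator 1 ζ.absDist * mixedRadon F ζ ∂affVolume V k < ∞ := by
  obtain ⟨a, ha, ht⟩ := ht
  obtain ⟨C, hC, hCτ⟩ := exists_mixedRadon_ball_le_zpow (V := V) (j := j) (k := k) hjk hA
  have hφ : Measurable fun ζ : AffGr V k => (Set.Iic A).indicator (1 : ℝ → ℝ≥0∞) ζ.absDist :=
    (measurable_one.indicator measurableSet_Iic).comp AffGr.continuous_absDist.measurable
  have hD : MeasurableSet {τ : AffGr V j | a < τ.absDist} :=
    (isOpen_lt continuous_const AffGr.continuous_absDist).measurableSet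
  rw [lintegral_mul_mixedRadon_comm hjk hF hφ, ← lintegral_add_compl _ hD]
  refine ENNReal.add_lt_top.mpr ⟨?_, ?_⟩
  · calc _ ≤ ∫⁻ τ in {τ : AffGr V j | a < τ.absDist}, C * (‖f τ‖ₑ *
          ENNReal.ofReal (τ.absDist ^ ((k : ℤ) + j - finrank ℝ V))) ∂affVolume V j := by
          refine lintegral_mono_ae ?_
          filter_upwards [ae_restrict_of_ae hfF, ae_restrict_mem hD] with τ h1 h2
          rw [← h1, mul_left_comm]
          gcongr
          exact hCτ τ (ha.trans h2)
      _ = C * _ := lintegral_const_mul' _ _ hC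
      _ < ∞ := ENNReal.mul_lt_top hC.lt_top ht
  · have hcompl : {τ : AffGr V j | a < τ.absDist}ᶜ = {τ | τ.absDist ≤ a} := by
      ext τ
      exact not_lt (a := a) (b := τ.absDist)
    have hint := (hf.integrableOn_isCompact (AffGr.isCompact_absDist_le a)).hasFiniteIntegral
    have hB : ENNReal.ofReal (A ^ j) * unitBallVol j ≠ ∞ :=
      ENNReal.mul_ne_top ENNReal.ofReal_ne_top (unitBallVol_ne_top j)
    rw [hcompl]
    calc _ ≤ ∫⁻ τ in {τ : AffGr V j | τ.absDist ≤ a}, ENNReal.ofReal (A ^ j) * unitBallVol j *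
          ‖f τ‖ₑ ∂affVolume V j := by
          refine lintegral_mono_ae ?_
          filter_upwards [ae_restrict_of_ae hfF] with τ h1
          rw [← h1, mul_comm]
          gcongr
          exact mixedRadon_ball_le_const τ hA
      _ = _ := lintegral_const_mul' _ _ hB
      _ < ∞ := ENNReal.mul_lt_top hB.lt_top hint

/-- A null set of `j`-planes is null for almost all of the measures that define the transform. -/
theorem ae_incidenceMeasure_eq_zero (hjk : j + k ≤ finrank ℝ V) {N : Set (AffGr V j)}
    (hN : MeasurableSet N) (h0 : affVolume V j N = 0) :
    ∀ᵐ ζ : AffGr V k ∂affVolume V k, incidenceMeasure j ζ N = 0 := by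
  have hm : Measurable (N.indicator (1 : AffGr V j → ℝ≥0∞)) := measurable_one.indicator hN
  have h1 : ∀ ζ : AffGr V k, mixedRadon (N.indicator (1 : AffGr V j → ℝ≥0∞)) ζ =
      incidenceMeasure j ζ N := fun ζ => lintegral_indicator_one hN
  have h := lintegral_mul_mixedRadon_comm hjk hm
    (measurable_one : Measurable (1 : AffGr V k → ℝ≥0∞))
  have h2 : ∫⁻ τ, N.indicator 1 τ * mixedRadon (1 : AffGr V k → ℝ≥0∞) τ ∂affVolume V j = 0 := by
    refine lintegral_eq_zero_of_ae_eq_zero ?_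
    filter_upwards [measure_eq_zero_iff_ae_notMem.mp h0] with τ hτ
    rw [Set.indicator_of_notMem hτ, zero_mul, Pi.zero_apply]
  rw [h2] at h
  simp only [Pi.one_apply, one_mul] at h
  filter_upwards [(lintegral_eq_zero_iff (measurable_mixedRadon hm)).mp h] with ζ hζ
  rw [← h1, hζ, Pi.zero_apply]

/-- Under the tail condition, the transform of a locally integrable function is finite almost
everywhere. -/
theorem ae_mixedRadonFinite {𝕜 : Type*} [RCLike 𝕜] (hjk : j + k ≤ finrank ℝ V)
    {f : AffGr V j → 𝕜} (hf : LocallyIntegrable f (affVolume V j))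
    (ht : TailIntegrable f ((k : ℤ) + j - finrank ℝ V)) :
    ∀ᵐ ζ : AffGr V k ∂affVolume V k, MixedRadonFinite f ζ := by
  obtain ⟨g, hg, hfg⟩ := hf.aestronglyMeasurable
  have hF : Measurable fun τ => ‖g τ‖ₑ := hg.measurable.enorm
  have hfF : (fun τ => ‖f τ‖ₑ) =ᵐ[affVolume V j] fun τ => ‖g τ‖ₑ := by
    filter_upwards [hfg] with τ hτ
    rw [hτ]
  have h1 : ∀ᵐ ζ : AffGr V k ∂affVolume V k, ∀ m : ℕ,
      (Set.Iic (m : ℝ)).indicator 1 ζ.absDist * mixedRadon (fun τ => ‖g τ‖ₑ) ζ < ∞ := by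
    refine ae_all_iff.mpr fun m => ae_lt_top ?_
      (lintegral_mul_mixedRadon_ball_lt_top hjk hf ht hF hfF (Nat.cast_nonneg m)).ne
    exact ((measurable_one.indicator measurableSet_Iic).comp
      AffGr.continuous_absDist.measurable).mul (measurable_mixedRadon hF)
  have h2 := ae_incidenceMeasure_eq_zero (k := k) hjk
    (measurableSet_toMeasurable (affVolume V j) {τ | f τ ≠ g τ})
    ((measure_toMeasurable _).trans hfg)
  filter_upwards [h1, h2] with ζ hζ1 hζ2
  have hae : f =ᵐ[incidenceMeasure j ζ] g :=
    measure_mono_null (subset_toMeasurable _ _) hζ2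
  refine (integrable_congr hae).mpr ⟨hg.aestronglyMeasurable, ?_⟩
  obtain ⟨m, hm⟩ := exists_nat_ge ζ.absDist
  have h := hζ1 m
  rwa [Set.indicator_of_mem (Set.mem_Iic.mpr hm), Pi.one_apply, one_mul] at h

end Finiteness

end MixedRadon

/-! ### Integrals of radial functions -/

namespace MixedRadon

section Radial

section Polar

variable {E : Type*} [NormedAddCommGroup E] [InnerProductSpace ℝ E] [FiniteDimensional ℝ E]
  [MeasurableSpace E] [BorelSpace E] [Nontrivial E]

/-- Integration of a radial function in polar coordinates. -/
theorem lintegral_comp_norm {g : ℝ → ℝ≥0∞} (hg : Measurable g) :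
    ∫⁻ x : E, g ‖x‖ = finrank ℝ E * unitBallVol (finrank ℝ E) *
      ∫⁻ t in Set.Ioi (0 : ℝ), ENNReal.ofReal (t ^ (finrank ℝ E - 1)) * g t := by
  have hm : Measurable fun t : Set.Ioi (0 : ℝ) => g t := hg.comp measurable_subtype_coe
  calc ∫⁻ x : E, g ‖x‖ = ∫⁻ x : ({0}ᶜ : Set E), g ‖(x : E)‖ ∂(volume.comap Subtype.val) := by
        rw [lintegral_subtype_comap (measurableSet_singleton _).compl fun x : E => g ‖x‖,
          restrict_compl_singleton]
    _ = ∫⁻ p, g (p.2 : ℝ) ∂(volume : Measure E).toSphere.prod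
          (Measure.volumeIoiPow (finrank ℝ E - 1)) := by
        rw [← (volume : Measure E).measurePreserving_homeomorphUnitSphereProd.lintegral_comp_emb
          (Homeomorph.measurableEmbedding _)]
        simp only [homeomorphUnitSphereProd_apply_snd_coe]
    _ = (volume : Measure E).toSphere Set.univ *
          ∫⁻ t, g (t : ℝ) ∂Measure.volumeIoiPow (finrank ℝ E - 1) := by
        rw [lintegral_prod (fun p : Metric.sphere (0 : E) 1 × Set.Ioi (0 : ℝ) => g (p.2 : ℝ))
          (hm.comp measurable_snd).aemeasurable]
        change ∫⁻ _, (∫⁻ t : Set.Ioi (0 : ℝ), g t ∂Measure.volumeIoiPow (finrank ℝ E - 1))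
          ∂(volume : Measure E).toSphere = _
        rw [lintegral_const, mul_comm]
    _ = _ := by
        rw [Measure.toSphere_apply_univ, ← Measure.addHaar_closedBall_eq_addHaar_ball,
          volume_unitBall_eq_unitBallVol, Measure.volumeIoiPow,
          lintegral_withDensity_eq_lintegral_mul _ (by fun_prop) hm]
        congr 1
        exact lintegral_subtype_comap measurableSet_Ioi
          fun t : ℝ => ENNReal.ofReal (t ^ (finrank ℝ E - 1)) * g t

/-- A radial function is almost everywhere measurable only if its profile is. The profile is
read off from the product structure of polar coordinates, in which it depends on one factor only. -/
theorem aemeasurable_of_comp_norm {f₀ : ℝ → ℝ}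
    (hf : AEMeasurable (fun x : E => f₀ ‖x‖) volume) :
    AEMeasurable f₀ (volume.restrict (Set.Ioi 0)) := by
  have h1 : AEMeasurable (fun x : ({0}ᶜ : Set E) => f₀ ‖(x : E)‖)
      ((volume : Measure E).comap (↑)) := by
    have h := hf.restrict (s := ({0}ᶜ : Set E))
    rw [← map_comap_subtype_coe (measurableSet_singleton (0 : E)).compl] at h
    exact h.comp_measurable measurable_subtype_coe
  have h2 : AEMeasurable (fun p : Metric.sphere (0 : E) 1 × Set.Ioi (0 : ℝ) => f₀ p.2)
      ((volume : Measure E).toSphere.prod (Measure.volumeIoiPow (finrank ℝ E - 1))) := by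
    rw [← (volume : Measure E).measurePreserving_homeomorphUnitSphereProd.aemeasurable_comp_iff
      (Homeomorph.measurableEmbedding _)]
    simpa only [Function.comp_def, homeomorphUnitSphereProd_apply_snd_coe] using h1
  have h3 : AEMeasurable (fun t : Set.Ioi (0 : ℝ) => f₀ t)
      (Measure.volumeIoiPow (finrank ℝ E - 1)) :=
    (h2.aestronglyMeasurable.of_comp_snd (by simp)).aemeasurable
  have h4 : AEMeasurable (fun t : Set.Ioi (0 : ℝ) => f₀ t) (Measure.comap Subtype.val volume) := by
    refine h3.mono_ac ?_
    refine withDensity_absolutelyContinuous' (by fun_prop) (Filter.Eventually.of_forall fun t => ?_)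
    exact (ENNReal.ofReal_pos.mpr (pow_pos t.2 _)).ne'
  rw [← map_comap_subtype_coe measurableSet_Ioi]
  exact (MeasurableEmbedding.subtype_coe measurableSet_Ioi).aemeasurable_map_iff.mpr h4

end Polar

/-- The substitution `r = √(t ^ 2 - s ^ 2)`, in which `r` is comparable to `t` for `t ≥ 2 s`. -/
theorem lintegral_Ioi_le_lintegral_sqrt (m : ℕ) (g : ℝ → ℝ≥0∞) {s a : ℝ} (hs : 0 ≤ s)
    (ha : 0 < a) (hsa : 2 * s ≤ a) :
    ∫⁻ t in Set.Ioi a, ENNReal.ofReal (t ^ m) * g t ≤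
      ENNReal.ofReal (2 ^ m) *
        ∫⁻ r in Set.Ioi (0 : ℝ), ENNReal.ofReal (r ^ m) * g √(r ^ 2 + s ^ 2) := by
  set h : ℝ → ℝ := fun t => √(t ^ 2 - s ^ 2) with hh
  have hpos : ∀ t ∈ Set.Ioi a, 0 < t ^ 2 - s ^ 2 := fun t ht => by
    have : a < t := ht
    nlinarith
  have hderiv : ∀ t ∈ Set.Ioi a, HasDerivWithinAt h (t / √(t ^ 2 - s ^ 2)) (Set.Ioi a) t :=
    fun t ht => by
      have h1 := (((hasDerivAt_pow 2 t).sub_const (s ^ 2)).sqrt (hpos t ht).ne').hasDerivWithinAt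
        (s := Set.Ioi a)
      refine h1.congr_deriv ?_
      have := Real.sqrt_pos.mpr (hpos t ht)
      field_simp
      norm_num
  have hinj : Set.InjOn h (Set.Ioi a) := fun t ht t' ht' heq => by
    have h1 := (Real.sqrt_inj (hpos t ht).le (hpos t' ht').le).mp heq
    have h2 : a < t := ht
    have h3 : a < t' := ht'
    nlinarith
  have himage : h '' Set.Ioi a ⊆ Set.Ioi 0 := by
    rintro _ ⟨t, ht, rfl⟩
    exact Real.sqrt_pos.mpr (hpos t ht)
  have hsub := lintegral_mono_set (μ := volume)
    (f := fun r => ENNReal.ofReal (r ^ m) * g √(r ^ 2 + s ^ 2)) himage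
  rw [lintegral_image_eq_lintegral_abs_deriv_mul measurableSet_Ioi hderiv hinj] at hsub
  refine le_trans ?_ (mul_le_mul_right hsub _)
  rw [← lintegral_const_mul' _ _ ENNReal.ofReal_ne_top]
  refine setLIntegral_mono' measurableSet_Ioi fun t ht => ?_
  have hat : a < t := ht
  have ht0 : 0 < t := ha.trans hat
  have hsq : √(t ^ 2 - s ^ 2) ^ 2 = t ^ 2 - s ^ 2 := Real.sq_sqrt (hpos t ht).le
  have hp := Real.sqrt_pos.mpr (hpos t ht)
  have hge : t / 2 ≤ √(t ^ 2 - s ^ 2) := Real.le_sqrt_of_sq_le (by nlinarith)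
  have hle : √(t ^ 2 - s ^ 2) ≤ t := Real.sqrt_le_iff.mpr ⟨ht0.le, by nlinarith⟩
  have hback : √(h t ^ 2 + s ^ 2) = t := by
    rw [hh]
    simp only
    rw [hsq, sub_add_cancel, Real.sqrt_sq ht0.le]
  rw [hback, ← mul_assoc, ← mul_assoc, ← ENNReal.ofReal_mul (by positivity),
    ← ENNReal.ofReal_mul (by positivity)]
  gcongr
  have h1 : 1 ≤ |t / √(t ^ 2 - s ^ 2)| := by
    rw [abs_of_pos (by positivity)]
    exact (one_le_div hp).mpr hle
  calc t ^ m = 2 ^ m * (t / 2) ^ m := by rw [← mul_pow, mul_div_cancel₀ t two_ne_zero]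
    _ ≤ 2 ^ m * h t ^ m := by gcongr
    _ = 2 ^ m * 1 * h t ^ m := by ring
    _ ≤ 2 ^ m * |t / √(t ^ 2 - s ^ 2)| * h t ^ m := by 
        gcongr


/-- A minorant that is measurable everywhere, which allows integration against measures that are
not absolutely continuous with respect to `μ`. -/
theorem exists_measurable_le_ae_eq {α : Type*} [MeasurableSpace α] {μ : Measure α}
    {h : α → ℝ≥0∞} (hh : AEMeasurable h μ) :
    ∃ g, Measurable g ∧ g ≤ h ∧ g =ᵐ[μ] h := by
  classical
  obtain ⟨g, hg, hgh⟩ := hh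
  set N := toMeasurable μ {x | h x ≠ g x} with hN
  have hN0 : μ N = 0 := (measure_toMeasurable _).trans hgh
  refine ⟨Nᶜ.indicator g, hg.indicator (measurableSet_toMeasurable _ _).compl, fun x => ?_, ?_⟩
  · by_cases hx : x ∈ N
    · rw [Set.indicator_of_notMem (Set.notMem_compl_iff.mpr hx)]
      exact zero_le
    · rw [Set.indicator_of_mem hx]
      by_contra hne
      exact hx (subset_toMeasurable _ _ fun h' => hne h'.ge)
  · filter_upwards [measure_eq_zero_iff_ae_notMem.mp hN0, hgh] with x hx hx'
    rw [Set.indicator_of_mem hx, hx']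

variable {V : Type*} [NormedAddCommGroup V] [InnerProductSpace ℝ V] [FiniteDimensional ℝ V]
  {j k : ℕ}

theorem LinGr.finrank_orthogonal (ξ : LinGr V j) : finrank ℝ ↥(ξ.spaceᗮ) = finrank ℝ V - j := by
  have := ξ.space.finrank_add_finrank_orthogonal
  rw [ξ.finrank_eq] at this
  omega

variable [MeasurableSpace V] [BorelSpace V]

theorem lintegral_affVolume_absDist (hj : j < finrank ℝ V) {h : ℝ → ℝ≥0∞} (hh : Measurable h) :
    ∫⁻ τ : AffGr V j, h τ.absDist ∂affVolume V j =
      ((finrank ℝ V - j : ℕ) : ℝ≥0∞) * unitBallVol (finrank ℝ V - j) *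
        ∫⁻ t in Set.Ioi (0 : ℝ), ENNReal.ofReal (t ^ (finrank ℝ V - j - 1)) * h t := by
  have := LinGr.isProbabilityMeasure_prob (V := V) hj.le
  rw [lintegral_affVolume (f := fun τ => h τ.absDist)
    (hh.comp AffGr.continuous_absDist.measurable)]
  have h1 : ∀ ξ : LinGr V j, ∫⁻ u : ↥(ξ.spaceᗮ), h (AffGr.mk' ξ (u : V)).absDist =
      ((finrank ℝ V - j : ℕ) : ℝ≥0∞) * unitBallVol (finrank ℝ V - j) *
        ∫⁻ t in Set.Ioi (0 : ℝ), ENNReal.ofReal (t ^ (finrank ℝ V - j - 1)) * h t := fun ξ => by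
    have : Nontrivial ↥(ξ.spaceᗮ) :=
      nontrivial_of_finrank_pos (R := ℝ) (by rw [ξ.finrank_orthogonal]; omega)
    have h2 := lintegral_comp_norm (E := ↥(ξ.spaceᗮ)) hh
    rw [ξ.finrank_orthogonal] at h2
    rw [← h2]
    refine lintegral_congr fun u => ?_
    rw [AffGr.absDist_eq_norm_foot, AffGr.foot_mk'_of_mem ξ u.2, Submodule.coe_norm]
  simp_rw [h1]
  simp

theorem aemeasurable_of_isRadial (hj : j < finrank ℝ V) {f₀ : ℝ → ℝ}
    (hf : AEMeasurable (fun τ : AffGr V j => f₀ τ.absDist) (affVolume V j)) :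
    AEMeasurable f₀ (volume.restrict (Set.Ioi 0)) := by
  have := LinGr.isProbabilityMeasure_prob (V := V) hj.le
  obtain ⟨F, hF, hfF⟩ := hf
  set N := toMeasurable (affVolume V j) {τ | f₀ τ.absDist ≠ F τ} with hN
  have hN0 : affVolume V j N = 0 := (measure_toMeasurable _).trans hfF
  have hNm : MeasurableSet N := measurableSet_toMeasurable _ _
  rw [affVolume, Measure.bind_apply hNm measurable_fiberVolume.aemeasurable,
    lintegral_eq_zero_iff (Measure.measurable_measure.mp measurable_fiberVolume N hNm)] at hN0
  obtain ⟨ξ, hξ⟩ := hN0.exists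
  replace hξ := (fiberVolume_apply ξ hNm).symm.trans hξ
  have : Nontrivial ↥(ξ.spaceᗮ) :=
    nontrivial_of_finrank_pos (R := ℝ) (by rw [ξ.finrank_orthogonal]; omega)
  refine aemeasurable_of_comp_norm (E := ↥(ξ.spaceᗮ)) ⟨fun u => F (AffGr.mk' ξ (u : V)),
    hF.comp ((measurable_mk'_right ξ).comp measurable_subtype_coe), ?_⟩
  refine measure_mono_null (fun u hu => ?_) hξ
  refine subset_toMeasurable _ _ fun h => hu ?_
  rw [AffGr.absDist_eq_norm_foot, AffGr.foot_mk'_of_mem ξ u.2] at h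
  exact h

/-- If a radial function violates the tail condition, then its profile is not integrable at infinity
against `t ^ (k - 1) dt`. Every value of the transform averages such integrals, by polar
coordinates in the `k`-dimensional direction of the plane. -/
theorem mixedRadon_eq_top_of_isRadial (hk : 0 < k) (hjk : j + k ≤ finrank ℝ V)
    {f : AffGr V j → ℝ} (hf0 : ∀ τ, 0 ≤ f τ) (hr : IsRadial f)
    (hf : LocallyIntegrable f (affVolume V j))
    (ht : ¬ TailIntegrable f ((k : ℤ) + j - finrank ℝ V)) (ζ : AffGr V k) :
    mixedRadon (fun τ => ENNReal.ofReal (f τ)) ζ = ∞ := by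
  have hj : j < finrank ℝ V := by omega
  obtain ⟨f₀, hr⟩ := hr
  have hfm := hf.aestronglyMeasurable.aemeasurable
  rw [funext hr] at hfm
  obtain ⟨g, hg, hgf, hgae⟩ :=
    exists_measurable_le_ae_eq (aemeasurable_of_isRadial hj hfm).ennreal_ofReal
  have hae : ∀ᵐ τ : AffGr V j ∂affVolume V j, 0 < τ.absDist →
      g τ.absDist = ENNReal.ofReal (f₀ τ.absDist) := by
    have hgae' := (ae_restrict_iff' measurableSet_Ioi).mp hgae
    set N := toMeasurable volume {t : ℝ | ¬ (t ∈ Set.Ioi (0 : ℝ) → g t = ENNReal.ofReal (f₀ t))}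
    have hN0 : volume N = 0 := (measure_toMeasurable _).trans hgae'
    have hNm : MeasurableSet N := measurableSet_toMeasurable _ _
    have hind : Measurable (N.indicator fun _ => (1 : ℝ≥0∞)) := measurable_const.indicator hNm
    have h1 := lintegral_affVolume_absDist hj hind
    have h2 : ∫⁻ t in Set.Ioi (0 : ℝ), ENNReal.ofReal (t ^ (finrank ℝ V - j - 1)) *
        N.indicator (fun _ => (1 : ℝ≥0∞)) t = 0 := by
      refine lintegral_eq_zero_of_ae_eq_zero ?_
      filter_upwards [ae_restrict_of_ae (measure_eq_zero_iff_ae_notMem.mp hN0)] with t ht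
      rw [Set.indicator_of_notMem ht, mul_zero, Pi.zero_apply]
    rw [h2, mul_zero, lintegral_eq_zero_iff (f := fun τ : AffGr V j =>
      N.indicator (fun _ => (1 : ℝ≥0∞)) τ.absDist)
      (hind.comp AffGr.continuous_absDist.measurable)] at h1
    filter_upwards [h1] with τ hτ
    by_contra hne
    have hmem : τ.absDist ∈ N := subset_toMeasurable _ _ hne
    exact one_ne_zero ((Set.indicator_of_mem hmem fun _ => (1 : ℝ≥0∞)).symm.trans hτ)
  have htail : ∀ a : ℝ, 0 < a →
      ∫⁻ t in Set.Ioi a, ENNReal.ofReal (t ^ (k - 1)) * g t = ∞ := by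
    intro a ha
    by_contra hne
    refine ht ⟨a, ha, ?_⟩
    set m := finrank ℝ V - j - k with hm
    have hz : (k : ℤ) + j - finrank ℝ V = -(m : ℤ) := by omega
    have hD : MeasurableSet {τ : AffGr V j | a < τ.absDist} :=
      (isOpen_lt continuous_const AffGr.continuous_absDist).measurableSet
    let h : ℝ → ℝ≥0∞ := (Set.Ioi a).indicator fun t => g t * ENNReal.ofReal (t ^ m)⁻¹
    have hh : Measurable h := (hg.mul (by fun_prop)).indicator measurableSet_Ioi
    calc ∫⁻ τ in {τ : AffGr V j | a < τ.absDist}, ‖f τ‖ₑ *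
          ENNReal.ofReal (τ.absDist ^ ((k : ℤ) + j - finrank ℝ V)) ∂affVolume V j
        ≤ ∫⁻ τ : AffGr V j, h τ.absDist ∂affVolume V j := by
          rw [← lintegral_indicator hD]
          refine lintegral_mono_ae ?_
          filter_upwards [hae] with τ hτ
          by_cases hτa : a < τ.absDist
          · have h1 : h τ.absDist = g τ.absDist * ENNReal.ofReal (τ.absDist ^ m)⁻¹ :=
              Set.indicator_of_mem (Set.mem_Ioi.mpr hτa) _
            rw [Set.indicator_of_mem (by exact hτa), h1, hτ (ha.trans hτa), ← hr,
              Real.enorm_of_nonneg (hf0 τ), hz, zpow_neg, zpow_natCast]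
          · rw [Set.indicator_of_notMem (by exact hτa)]
            exact zero_le
      _ = _ := lintegral_affVolume_absDist hj hh
      _ < ∞ := by
          refine ENNReal.mul_lt_top (ENNReal.mul_lt_top (ENNReal.natCast_lt_top _)
            (unitBallVol_ne_top _).lt_top) (lt_of_le_of_lt ?_ (lt_top_iff_ne_top.mpr hne))
          refine (setLIntegral_le_lintegral _ _).trans ?_
          rw [← lintegral_indicator measurableSet_Ioi]
          refine lintegral_mono fun t => ?_
          by_cases hta : t ∈ Set.Ioi a
          · have ht0 : 0 < t := ha.trans hta
            have h1 : h t = g t * ENNReal.ofReal (t ^ m)⁻¹ := Set.indicator_of_mem hta _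
            have h2 : finrank ℝ V - j - 1 = k - 1 + m := by omega
            rw [Set.indicator_of_mem hta, h1, mul_left_comm, ← ENNReal.ofReal_mul (by positivity),
              h2, pow_add, mul_inv_cancel_right₀ (by positivity), mul_comm]
          · have h1 : h t = 0 := Set.indicator_of_notMem hta _
            rw [h1, mul_zero]
            exact zero_le
  have hle : mixedRadon (fun τ : AffGr V j => g τ.absDist) ζ ≤
      mixedRadon (fun τ => ENNReal.ofReal (f τ)) ζ := lintegral_mono fun τ => by
    rw [hr τ]
    exact hgf _
  rw [← top_le_iff]
  refine le_trans ?_ hle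
  have hW : finrank ℝ ↥(ζ.dir.spaceᗮ) = finrank ℝ V - k := ζ.dir.finrank_orthogonal
  have := LinGr.isProbabilityMeasure_prob (V := ↥(ζ.dir.spaceᗮ)) (j := j) (by omega)
  have hkd : finrank ℝ ζ.dir.space = k := ζ.dir.finrank_eq
  have : Nontrivial ζ.dir.space := nontrivial_of_finrank_pos (R := ℝ) (by omega)
  have hinner : ∀ s : ℝ, 0 ≤ s → ∫⁻ u : ζ.dir.space, g √(‖u‖ ^ 2 + s ^ 2) = ∞ := fun s hs => by
    rw [lintegral_comp_norm (E := ζ.dir.space) (g := fun r => g √(r ^ 2 + s ^ 2))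
      (hg.comp (by fun_prop)), hkd]
    -- Any bound beyond `2 s` will do, as the tail integral diverges from every starting point.
    have h1 := lintegral_Ioi_le_lintegral_sqrt (k - 1) g (a := 2 * s + 1) hs (by positivity)
      (by linarith)
    rw [htail _ (by positivity), top_le_iff] at h1
    have h2 := ((ENNReal.mul_eq_top.mp h1).resolve_right fun h => ENNReal.ofReal_ne_top h.1).2
    rw [h2]
    exact ENNReal.mul_top (mul_ne_zero (Nat.cast_ne_zero.mpr hk.ne') (unitBallVol_ne_zero k))
  rw [lintegral_incidenceMeasure_absDist ζ hg]
  simp_rw [hinner _ (norm_nonneg _)]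
  simp

end Radial

end MixedRadon

theorem mainTheorem4 {𝕜 : Type*} [RCLike 𝕜] (n j k : ℕ) (hj : 0 < j) (hk : 0 < k)
    (hjk : j + k < n) :
    ((∀ f : AffGr (EuclideanSpace ℝ (Fin n)) j → 𝕜,
        LocallyIntegrable f (affVolume (EuclideanSpace ℝ (Fin n)) j) →
        TailIntegrable f ((k : ℤ) + j - n) →
        ∀ᵐ ζ : AffGr (EuclideanSpace ℝ (Fin n)) k ∂affVolume (EuclideanSpace ℝ (Fin n)) k,
          MixedRadonFinite f ζ) ∧
      (∀ f : AffGr (EuclideanSpace ℝ (Fin n)) j → ℝ,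
        (∀ τ, 0 ≤ f τ) → IsRadial f →
        LocallyIntegrable f (affVolume (EuclideanSpace ℝ (Fin n)) j) →
        ¬ TailIntegrable f ((k : ℤ) + j - n) →
        ∀ ζ : AffGr (EuclideanSpace ℝ (Fin n)) k,
          mixedRadon (fun τ => ENNReal.ofReal (f τ)) ζ = ∞)) ∧
    ((∀ φ : AffGr (EuclideanSpace ℝ (Fin n)) k → 𝕜,
        LocallyIntegrable φ (affVolume (EuclideanSpace ℝ (Fin n)) k) →
        TailIntegrable φ ((k : ℤ) + j - n) →
        ∀ᵐ τ : AffGr (EuclideanSpace ℝ (Fin n)) j ∂affVolume (EuclideanSpace ℝ (Fin n)) j,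
          MixedRadonFinite φ τ) ∧
      (∀ φ : AffGr (EuclideanSpace ℝ (Fin n)) k → ℝ,
        (∀ ζ, 0 ≤ φ ζ) → IsRadial φ →
        LocallyIntegrable φ (affVolume (EuclideanSpace ℝ (Fin n)) k) →
        ¬ TailIntegrable φ ((k : ℤ) + j - n) →
        ∀ τ : AffGr (EuclideanSpace ℝ (Fin n)) j,
          mixedRadon (fun ζ => ENNReal.ofReal (φ ζ)) τ = ∞)) := by
  have hn : ((finrank ℝ (EuclideanSpace ℝ (Fin n)) : ℕ) : ℤ) = n := by
    rw [finrank_euclideanSpace_fin]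
  have h1 : j + k ≤ finrank ℝ (EuclideanSpace ℝ (Fin n)) := by
    rw [finrank_euclideanSpace_fin]
    exact hjk.le
  have h2 : k + j ≤ finrank ℝ (EuclideanSpace ℝ (Fin n)) := by rwa [add_comm]
  have hp : (k : ℤ) + j - n = (k : ℤ) + j - finrank ℝ (EuclideanSpace ℝ (Fin n)) := by rw [hn]
  have hp' : (k : ℤ) + j - n = (j : ℤ) + k - finrank ℝ (EuclideanSpace ℝ (Fin n)) := by
    rw [hn, add_comm (k : ℤ)]
  refine ⟨⟨fun f hf ht => ?_, fun f hf0 hr hf ht => ?_⟩,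
    ⟨fun φ hφ ht => ?_, fun φ hφ0 hr hφ ht => ?_⟩⟩
  · exact ae_mixedRadonFinite h1 hf (hp ▸ ht)
  · exact mixedRadon_eq_top_of_isRadial hk h1 hf0 hr hf (hp ▸ ht)
  · exact ae_mixedRadonFinite h2 hφ (hp' ▸ ht)
  · exact mixedRadon_eq_top_of_isRadial hj h2 hφ0 hr hφ (hp' ▸ ht)
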